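/- Let $\mathbf k$ be a commutative $\mathbb Q$-algebra, $F_2$ the free group on $X_0,X_1$, and $\mathcal V=\mathbf kF_2$ its group algebra. In $\mathcal V\otimes\mathcal V$ write $X_i=X_i\otimes1$ and $Y_i=1\otimes X_i$. For a group $G$ let $\mathrm{op}_G$ be the anti-automorphism $g\mapsto g^{-1}$ of $\mathbf kG$. *The explicit bimodule.* Let $\underline\rho:\mathcal V\to M_3(\mathcal V\otimes\mathcal V)$ be the algebra morphism with $$\underline\rho(X_0)=\begin{pmatrix}X_0&0&0\\0&(1-X_1)X_0+Y_1^{-1}Y_0Y_1&(1-X_1)X_0X_1\\0&X_0-Y_1^{-1}Y_0Y_1X_1^{-1}&X_0X_1\end{pmatrix},\quad \underline\rho(X_1)=\begin{pmatrix}(X_1-1)Y_1+1&Y_1(1-Y_1)&0\\1-X_1&Y_1&0\\0&0&1\end{pmatrix},$$ and, with $D=\mathrm{diag}(Y_1,X_1,(X_0X_1)^{-1}Y_1^{-1}Y_0Y_1)$, let $\mathsf r\underline\rho(v)=D^{-1}\cdot\mathrm{op}_{F_2^2}\big({}^t\underline\rho(\mathrm{op}_{F_2}(v))\big)\cdot D$,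 where $\mathrm{op}_{F_2^2}=\mathrm{op}_{F_2}\otimes\mathrm{op}_{F_2}$ is applied entrywise. Then $(\mathcal V\otimes\mathcal V)^{\oplus3}$ (columns) is a $(\mathcal V,\mathcal V\otimes\mathcal V)$-bimodule, with left action $\mathsf r\underline\rho$. *The geometric bimodule.* Let $K_4$ be the group with generators $x_{ij}$ ($1\le i<j\le4$) and relations $(x_{ij}x_{ik}x_{jk},x_{ij})=(x_{ij}x_{ik}x_{jk},x_{ik})=(x_{ij}x_{ik}x_{jk},x_{jk})=1$ for $i<j<k$ and $(x_{12},x_{34})=(x_{13},x_{12}^{-1}x_{24}x_{12})=(x_{14},x_{23})=1$, where $(g,h)=ghg^{-1}h^{-1}$, and let $P_5^*=K_4/Z(K_4)$. Let $\mathrm{pr}_1,\mathrm{pr}_2,\mathrm{pr}_5:P_5^*\to F_2$ be the group morphisms which send $(x_{12},x_{13},x_{14},x_{23},x_{24},x_{34})$ to $(1,1,1,X_0,(X_1X_0)^{-1},X_1)$, $(1,(X_0X_1)^{-1},X_0,1,1,X_1)$ and $(X_1,(X_0X_1)^{-1},X_0,X_0,(X_1X_0)^{-1},X_1)$ respectively.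 Let $\ell:F_2\to P_5^*$, $X_0\mapsto x_{23}$, $X_1\mapsto x_{12}$. Denote by $\mathrm{pr}_5:\mathbf kP_5^*\to\mathcal V$, $\ell:\mathcal V\to\mathbf kP_5^*$ and $\mathrm{pr}_{12}:\mathbf kP_5^*\to\mathcal V\otimes\mathcal V$, $p\mapsto\mathrm{pr}_1(p)\otimes\mathrm{pr}_2(p)$ for $p\in P_5^*$, the induced algebra morphisms. Set $$\mathbf M=\ker(\mathrm{pr}_5)\otimes_{\mathbf kP_5^*}(\mathcal V\otimes\mathcal V),$$ where $\mathbf kP_5^*$ acts on $\mathcal V\otimes\mathcal V$ from the left through $\mathrm{pr}_{12}$. It is a $(\mathcal V,\mathcal V\otimes\mathcal V)$-bimodule, with left action $\mathsf r\underline{\boldsymbol\rho}(v)(p\otimes w)=\ell(v)p\otimes w$. Put $x_{15}=(x_{12}x_{13}x_{14})^{-1}$, $x_{25}=(x_{12}x_{23}x_{24})^{-1}$, $x_{35}=(x_{13}x_{23}x_{34})^{-1}$ in $P_5^*$; the elements $x_{i5}-1$ lie in $\ker(\mathrm{pr}_5)$. *Filtrations.* For a group $G$ let $F^n\mathbf kG=\mathbf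 kG$ for $n\le0$ and $F^n\mathbf kG=I_G^n$ for $n\ge1$, where $I_G$ is the augmentation ideal. For $n\ge0$ set $F^n(\mathcal V\otimes\mathcal V)=\sum_{i+j=n,\ i,j\ge0}F^i\mathcal V\otimes F^j\mathcal V$ (image in $\mathcal V\otimes\mathcal V$), $F^n\big((\mathcal V\otimes\mathcal V)^{\oplus3}\big)=\big(F^n(\mathcal V\otimes\mathcal V)\big)^{\oplus3}$, and let $F^n\mathbf M$ be the image of $F^n\mathbf kP_5^*\cap\ker(\mathrm{pr}_5)$ under $x\mapsto x\otimes1$; for $n<0$, $F^n=F^0$. **Theorem.** The map $$\Phi:(\mathcal V\otimes\mathcal V)^{\oplus3}\to\mathbf M,\qquad(a_1,a_2,a_3)\mapsto\sum_{i=1}^3(x_{i5}-1)\otimes a_i$$ is an isomorphism of right $(\mathcal V\otimes\mathcal V)$-modules, and $\Phi(\mathsf r\underline\rho(v)a)=\mathsf r\underline{\boldsymbol\rho}(v)\Phi(a)$ for all $v\in\mathcal V$ and $a\in(\mathcal V\otimes\mathcal V)^{\oplus3}$; so $\Phi$ is an isomorphism of $(\mathcal V,\mathcal V\otimes\mathcal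 V)$-bimodules. Moreover, with the filtrations above, both sides are filtered bimodules over the filtered algebras $\mathcal V$ and $\mathcal V\otimes\mathcal V$ (the filtrations are decreasing and compatible with both actions), and $\Phi$ is an isomorphism of filtered modules up to a shift by one: $$\Phi\big(F^{n-1}(\mathcal V\otimes\mathcal V)^{\oplus3}\big)=F^n\mathbf M\qquad\text{for all }n\in\mathbb Z.$$ -/

import Mathlib

open TensorProduct MulOpposite

noncomputable section

namespace BettiBimodule

/-! ### Group algebras and their augmentation filtration -/

/-- The algebra morphism `k φ : k G → k H` induced by a group morphism `φ : G → H`. -/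
def groupAlgMap (k : Type*) [CommRing k] {G H : Type*} [Group G] [Group H] (φ : G →* H) :
    MonoidAlgebra k G →ₐ[k] MonoidAlgebra k H :=
  MonoidAlgebra.lift k (MonoidAlgebra k H) G ((MonoidAlgebra.of k H).comp φ)

theorem groupAlgMap_of (k : Type*) [CommRing k] {G H : Type*} [Group G] [Group H] (φ : G →* H)
    (g : G) : groupAlgMap k φ (MonoidAlgebra.of k G g) = MonoidAlgebra.of k H (φ g) :=
  MonoidAlgebra.lift_of _ _

/-- The algebra antiautomorphism `op_G` of `k G` with `g ↦ g⁻¹`, as an algebra morphism from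
`k G` to its opposite algebra. -/
def opG (k : Type*) [CommRing k] (G : Type*) [Group G] :
    MonoidAlgebra k G →ₐ[k] (MonoidAlgebra k G)ᵐᵒᵖ :=
  MonoidAlgebra.lift k (MonoidAlgebra k G)ᵐᵒᵖ G
    { toFun := fun g => op (MonoidAlgebra.of k G g⁻¹)
      map_one' := by rw [inv_one, map_one, op_one]
      map_mul' := fun g h => by rw [mul_inv_rev, map_mul, op_mul] }

/-- The augmentation ideal of `k G`: the `k`-submodule generated by the elements `g - 1`. -/
def augIdeal (k : Type*) [CommRing k] (G : Type*) [Group G] : Submodule k (MonoidAlgebra k G) :=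
  Submodule.span k (Set.range fun g : G => MonoidAlgebra.of k G g - 1)

/-- The filtration of `k G`: everything in degrees `n ≤ 0`, the `n`-th power of the augmentation
ideal in degrees `n ≥ 1`. -/
def augFil (k : Type*) [CommRing k] (G : Type*) [Group G] (n : ℤ) :
    Submodule k (MonoidAlgebra k G) :=
  if n ≤ 0 then ⊤ else augIdeal k G ^ n.toNat

/-! ### The algebra `V`, and `V ⊗ V` -/

/-- The free group with generators `X₀` and `X₁`. -/
abbrev F2 : Type := FreeGroup (Fin 2)

/-- The group algebra of the free group `F₂`. -/
abbrev VB (k : Type*) [CommRing k] : Type _ := MonoidAlgebra k F2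

/-- The algebra `V ⊗ V`. -/
abbrev VV (k : Type*) [CommRing k] : Type _ := VB k ⊗[k] VB k

/-- The filtration of `V ⊗ V`: in degree `n ≥ 0` it is the sum over `i + j = n` (`i, j ≥ 0`) of the
images of `Fⁱ V ⊗ Fʲ V`; in negative degrees it is everything. -/
def filVV (k : Type*) [CommRing k] (n : ℤ) : Submodule k (VV k) :=
  ⨆ (i : ℕ) (j : ℕ) (_ : i + j = n.toNat),
    LinearMap.range (TensorProduct.map (augFil k F2 (i : ℤ)).subtype (augFil k F2 (j : ℤ)).subtype)

/-- The filtration of `(V ⊗ V)^{⊕ 3}`: componentwise. -/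
def filVV3 (k : Type*) [CommRing k] (n : ℤ) : Submodule k (Fin 3 → VV k) :=
  Submodule.pi Set.univ fun _ => filVV k n

/-- `X_i ⊗ 1`, as a unit of `V ⊗ V`. -/
def XU (k : Type*) [CommRing k] (i : Fin 2) : (VV k)ˣ :=
  Units.map ((Algebra.TensorProduct.includeLeft : VB k →ₐ[k] VV k) : VB k →* VV k)
    (Units.map (MonoidAlgebra.of k F2) (toUnits (FreeGroup.of i)))

/-- `Y_i = 1 ⊗ X_i`, as a unit of `V ⊗ V`. -/
def YU (k : Type*) [CommRing k] (i : Fin 2) : (VV k)ˣ :=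
  Units.map ((Algebra.TensorProduct.includeRight : VB k →ₐ[k] VV k) : VB k →* VV k)
    (Units.map (MonoidAlgebra.of k F2) (toUnits (FreeGroup.of i)))

/-! ### The explicit bimodule `(V ⊗ V)^{⊕ 3}` -/

section Matrices

variable {A : Type*} [Ring A]

/-- The matrix `ρ(X₀)`, with entries written in invertible elements `X₀, X₁, Y₀, Y₁`. -/
def rhoMat0 (X0 X1 Y0 Y1 : Aˣ) : Matrix (Fin 3) (Fin 3) A :=
  !![(X0 : A), 0, 0;
     0, (1 - X1) * X0 + ↑Y1⁻¹ * Y0 * Y1, (1 - X1) * X0 * X1;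
     0, X0 - ↑Y1⁻¹ * Y0 * Y1 * ↑X1⁻¹, X0 * X1]

/-- The inverse of `ρ(X₀)`. -/
def rhoMat0Inv (X0 X1 Y0 Y1 : Aˣ) : Matrix (Fin 3) (Fin 3) A :=
  !![(↑X0⁻¹ : A), 0, 0;
     0, X1 * ↑Y1⁻¹ * ↑Y0⁻¹ * Y1, X1 * X1 * ↑Y1⁻¹ * ↑Y0⁻¹ * Y1 - X1 * ↑Y1⁻¹ * ↑Y0⁻¹ * Y1;
     0, ↑X1⁻¹ * ↑X0⁻¹ - ↑Y1⁻¹ * ↑Y0⁻¹ * Y1,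
        ↑Y1⁻¹ * ↑Y0⁻¹ * Y1 - X1 * ↑Y1⁻¹ * ↑Y0⁻¹ * Y1 + ↑X1⁻¹ * ↑X0⁻¹ * X1]

/-- The matrix `ρ(X₁)`. -/
def rhoMat1 (X1 Y1 : Aˣ) : Matrix (Fin 3) (Fin 3) A :=
  !![(X1 - 1) * (Y1 : A) + 1, Y1 * (1 - Y1), 0;
     1 - X1, Y1, 0;
     0, 0, 1]

/-- The inverse of `ρ(X₁)`. -/
def rhoMat1Inv (X1 Y1 : Aˣ) : Matrix (Fin 3) (Fin 3) A :=
  !![(↑X1⁻¹ : A), ↑X1⁻¹ * Y1 - ↑X1⁻¹, 0;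
     ↑Y1⁻¹ - ↑X1⁻¹ * ↑Y1⁻¹, 1 - ↑X1⁻¹ + ↑X1⁻¹ * ↑Y1⁻¹, 0;
     0, 0, 1]

/-- Elements of the first factor commute with elements of the second factor. -/
structure CommUnits (X0 X1 Y0 Y1 : Aˣ) : Prop where
  h00 : Commute (X0 : A) Y0
  h01 : Commute (X0 : A) Y1
  h10 : Commute (X1 : A) Y0
  h11 : Commute (X1 : A) Y1

theorem comm_simps {x y : Aˣ} (h : Commute (x : A) y) :
    (↑y * ↑x : A) = ↑x * ↑y ∧ (↑y⁻¹ * ↑x : A) = ↑x * ↑y⁻¹ ∧ (↑y * ↑x⁻¹ : A) = ↑x⁻¹ * ↑y ∧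
    (↑y⁻¹ * ↑x⁻¹ : A) = ↑x⁻¹ * ↑y⁻¹ ∧ (∀ z : A, ↑y * (↑x * z) = ↑x * (↑y * z)) ∧
    (∀ z : A, ↑y⁻¹ * (↑x * z) = ↑x * (↑y⁻¹ * z)) ∧ (∀ z : A, ↑y * (↑x⁻¹ * z) = ↑x⁻¹ * (↑y * z)) ∧
    (∀ z : A, ↑y⁻¹ * (↑x⁻¹ * z) = ↑x⁻¹ * (↑y⁻¹ * z)) := by
  have h1 := h.symm
  have h2 := h.units_inv_right.symm
  have h3 := h.units_inv_left.symm
  have h4 := h.units_inv_left.units_inv_right.symm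
  exact ⟨h1, h2, h3, h4, h1.left_comm, h2.left_comm, h3.left_comm, h4.left_comm⟩

theorem rhoMat0_mul_inv {X0 X1 Y0 Y1 : Aˣ} (h : CommUnits X0 X1 Y0 Y1) :
    rhoMat0 X0 X1 Y0 Y1 * rhoMat0Inv X0 X1 Y0 Y1 = 1 := by
  obtain ⟨-, -, h10, h11⟩ := h
  ext i j
  fin_cases i <;> fin_cases j <;>
    simp [rhoMat0, rhoMat0Inv, Matrix.mul_apply, Fin.sum_univ_three, mul_add, add_mul, mul_sub,
      sub_mul, mul_assoc, comm_simps h10, comm_simps h11] <;>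
    abel

theorem rhoMat0_inv_mul {X0 X1 Y0 Y1 : Aˣ} (h : CommUnits X0 X1 Y0 Y1) :
    rhoMat0Inv X0 X1 Y0 Y1 * rhoMat0 X0 X1 Y0 Y1 = 1 := by
  obtain ⟨h00, h01, h10, h11⟩ := h
  ext i j
  fin_cases i <;> fin_cases j <;>
    simp [rhoMat0, rhoMat0Inv, Matrix.mul_apply, Fin.sum_univ_three, mul_add, add_mul, mul_sub,
      sub_mul, mul_assoc, comm_simps h00, comm_simps h01, comm_simps h10, comm_simps h11] <;>
    abel

theorem rhoMat1_mul_inv {X1 Y1 : Aˣ} (h : Commute (X1 : A) Y1) :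
    rhoMat1 X1 Y1 * rhoMat1Inv X1 Y1 = 1 := by
  ext i j
  fin_cases i <;> fin_cases j <;>
    simp [rhoMat1, rhoMat1Inv, Matrix.mul_apply, Fin.sum_univ_three, mul_add, add_mul, mul_sub,
      sub_mul, mul_assoc, comm_simps h] <;>
    abel

theorem rhoMat1_inv_mul {X1 Y1 : Aˣ} (h : Commute (X1 : A) Y1) :
    rhoMat1Inv X1 Y1 * rhoMat1 X1 Y1 = 1 := by
  ext i j
  fin_cases i <;> fin_cases j <;>
    simp [rhoMat1, rhoMat1Inv, Matrix.mul_apply, Fin.sum_univ_three, mul_add, add_mul, mul_sub,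
      sub_mul, mul_assoc, comm_simps h] <;>
    abel

end Matrices

section Rho

variable (k : Type*) [CommRing k]

theorem commute_X_Y (i j : Fin 2) : Commute (XU k i : VV k) (YU k j) := by
  simp [XU, YU, Commute, SemiconjBy]

theorem commUnits_X_Y : CommUnits (XU k 0) (XU k 1) (YU k 0) (YU k 1) :=
  ⟨commute_X_Y k 0 0, commute_X_Y k 0 1, commute_X_Y k 1 0, commute_X_Y k 1 1⟩

/-- The algebra morphism `ρ : V → M₃(V ⊗ V)` with the prescribed values on `X₀` and `X₁`. -/
def rhoUnd : VB k →ₐ[k] Matrix (Fin 3) (Fin 3) (VV k) :=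
  MonoidAlgebra.lift k (Matrix (Fin 3) (Fin 3) (VV k)) F2
    ((Units.coeHom (Matrix (Fin 3) (Fin 3) (VV k))).comp
      (FreeGroup.lift
        ![⟨rhoMat0 (XU k 0) (XU k 1) (YU k 0) (YU k 1),
            rhoMat0Inv (XU k 0) (XU k 1) (YU k 0) (YU k 1),
            rhoMat0_mul_inv (commUnits_X_Y k), rhoMat0_inv_mul (commUnits_X_Y k)⟩,
          ⟨rhoMat1 (XU k 1) (YU k 1), rhoMat1Inv (XU k 1) (YU k 1),
            rhoMat1_mul_inv (commute_X_Y k 1 1), rhoMat1_inv_mul (commute_X_Y k 1 1)⟩]))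

/-- The antiautomorphism `op_{F₂²}` of `V ⊗ V = k[F₂ × F₂]`, which is `op_{F₂} ⊗ op_{F₂}`, as an
algebra morphism out of the opposite algebra. -/
def opVV : (VV k)ᵐᵒᵖ →ₐ[k] VV k :=
  AlgHom.opComm
    (((Algebra.TensorProduct.opAlgEquiv k k (VB k) (VB k)) :
        (VB k)ᵐᵒᵖ ⊗[k] (VB k)ᵐᵒᵖ →ₐ[k] (VV k)ᵐᵒᵖ).comp
      (Algebra.TensorProduct.map (opG k F2) (opG k F2)))

/-- The diagonal entries `Y₁`, `X₁`, `(X₀ X₁)⁻¹ Y₁⁻¹ Y₀ Y₁`. -/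
def diagU : Fin 3 → (VV k)ˣ :=
  ![YU k 1, XU k 1, (XU k 0 * XU k 1)⁻¹ * (YU k 1)⁻¹ * YU k 0 * YU k 1]

/-- For a tuple `d` of invertible elements, the automorphism `M ↦ diag(d)⁻¹ M diag(d)`
of the matrix algebra. -/
def adDiagInv {A : Type*} [Ring A] [Algebra k A] (d : Fin 3 → Aˣ) :
    Matrix (Fin 3) (Fin 3) A →ₐ[k] Matrix (Fin 3) (Fin 3) A :=
  AlgHom.ofLinearMap
    { toFun := fun M => Matrix.diagonal (fun i => (↑(d i)⁻¹ : A)) * M *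
        Matrix.diagonal (fun i => (d i : A))
      map_add' := fun M N => by rw [mul_add, add_mul]
      map_smul' := fun c M => by simp }
    (by simp [Matrix.diagonal_mul_diagonal])
    (fun M N => by
      have h : Matrix.diagonal (fun i => (d i : A)) * Matrix.diagonal (fun i => (↑(d i)⁻¹ : A)) = 1 := by
        simp [Matrix.diagonal_mul_diagonal]
      simp only [LinearMap.coe_mk, AddHom.coe_mk]
      calc _ = Matrix.diagonal (fun i => (↑(d i)⁻¹ : A)) * M * 1 * N *
                Matrix.diagonal (fun i => (d i : A)) := by simp only [mul_one, mul_assoc]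
        _ = _ := by rw [← h]; simp only [mul_assoc])

/-- The algebra morphism
`rρ = Ad(diag(Y₁, X₁, (X₀X₁)⁻¹Y₁⁻¹Y₀Y₁)⁻¹) ∘ M₃(op) ∘ transpose ∘ ρ ∘ op : V → M₃(V ⊗ V)`.
(`AlgEquiv.mopMatrix.symm` is the transposition, from the opposite of a matrix algebra to the
matrix algebra over the opposite algebra.) -/
def rRho : VB k →ₐ[k] Matrix (Fin 3) (Fin 3) (VV k) :=
  (adDiagInv k (diagU k)).comp
    ((opVV k).mapMatrix.comp
      (((AlgEquiv.mopMatrix (R := k) (m := Fin 3) (α := VV k)).symm :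
          (Matrix (Fin 3) (Fin 3) (VV k))ᵐᵒᵖ →ₐ[k] Matrix (Fin 3) (Fin 3) (VV k)ᵐᵒᵖ).comp
        ((AlgHom.op (rhoUnd k)).comp (opG k F2))))

/-- Matrices over `A` acting on columns, by endomorphisms of the right `A`-module `A^{⊕ 3}`. -/
def matAct (A : Type*) [Ring A] [Algebra k A] :
    Matrix (Fin 3) (Fin 3) A →ₐ[k] Module.End Aᵐᵒᵖ (Fin 3 → A) :=
  AlgHom.ofLinearMap
    { toFun := fun M =>
        { toFun := fun a => M.mulVec a
          map_add' := fun a b => Matrix.mulVec_add M a b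
          map_smul' := fun c a => Matrix.mulVec_smul M c a }
      map_add' := fun M N => LinearMap.ext fun a => Matrix.add_mulVec M N a
      map_smul' := fun c M => LinearMap.ext fun a => Matrix.smul_mulVec c M a }
    (LinearMap.ext fun a => Matrix.one_mulVec a)
    (fun M N => LinearMap.ext fun a => (Matrix.mulVec_mulVec a M N).symm)

/-- The left action of `V` on the right `V ⊗ V`-module `(V ⊗ V)^{⊕ 3}`, given by `rρ`. -/
def rRhoAct : VB k →ₐ[k] Module.End (VV k)ᵐᵒᵖ (Fin 3 → VV k) :=
  (matAct k (VV k)).comp (rRho k)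

end Rho

/-! ### The tensor product `ker f ⊗_B A` -/

section KerTensor

variable {k : Type*} [CommRing k] {B C A : Type*} [Ring B] [Algebra k B] [Ring C] [Algebra k C]
  [Ring A] [Algebra k A]

/-- The kernel of an algebra morphism, as a `k`-module. -/
def KerMod (f : B →ₐ[k] C) : Type _ := LinearMap.ker f.toLinearMap

instance (f : B →ₐ[k] C) : AddCommGroup (KerMod f) :=
  inferInstanceAs (AddCommGroup (LinearMap.ker f.toLinearMap))

instance (f : B →ₐ[k] C) : Module k (KerMod f) :=
  inferInstanceAs (Module k (LinearMap.ker f.toLinearMap))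

/-- The element of `ker f` given by `b : B` with `f b = 0`. -/
def KerMod.of (f : B →ₐ[k] C) (b : B) (h : f b = 0) : KerMod f := ⟨b, h⟩

/-- The inclusion `ker f → B`. -/
def KerMod.incl (f : B →ₐ[k] C) : KerMod f →ₗ[k] B := (LinearMap.ker f.toLinearMap).subtype

theorem KerMod.incl_of (f : B →ₐ[k] C) (b : B) (h : f b = 0) :
    KerMod.incl f (KerMod.of f b h) = b := rfl

theorem KerMod.map_incl (f : B →ₐ[k] C) (n : KerMod f) : f (KerMod.incl f n) = 0 := n.2

theorem KerMod.ext {f : B →ₐ[k] C} {m n : KerMod f} (h : KerMod.incl f m = KerMod.incl f n) :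
    m = n := Subtype.ext h

/-- Right multiplication by `b` on the two-sided ideal `ker f`. -/
def kerMulRight (f : B →ₐ[k] C) (b : B) : KerMod f →ₗ[k] KerMod f where
  toFun n := KerMod.of f (KerMod.incl f n * b) (by rw [map_mul, KerMod.map_incl, zero_mul])
  map_add' m n := KerMod.ext (by simp only [map_add, KerMod.incl_of, add_mul])
  map_smul' r n := KerMod.ext (by
    simp only [map_smul, KerMod.incl_of, smul_mul_assoc, RingHom.id_apply])

/-- Left multiplication on the two-sided ideal `ker f`. -/
def kerMulLeft (f : B →ₐ[k] C) : B →ₐ[k] Module.End k (KerMod f) :=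
  AlgHom.ofLinearMap
    { toFun := fun b =>
        { toFun := fun n =>
            KerMod.of f (b * KerMod.incl f n) (by rw [map_mul, KerMod.map_incl, mul_zero])
          map_add' := fun m n => KerMod.ext (by simp only [map_add, KerMod.incl_of, mul_add])
          map_smul' := fun r n => KerMod.ext (by
            simp only [map_smul, KerMod.incl_of, mul_smul_comm, RingHom.id_apply]) }
      map_add' := fun b c => LinearMap.ext fun n => KerMod.ext (add_mul b c _)
      map_smul' := fun r b => LinearMap.ext fun n => KerMod.ext (smul_mul_assoc r b _) }
    (LinearMap.ext fun n => KerMod.ext (one_mul _))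
    (fun b c => LinearMap.ext fun n => KerMod.ext (mul_assoc b c _))

/-- The relations `n b ⊗ a = n ⊗ g(b) a` imposed on `ker f ⊗_k A`. -/
def balancedRel (f : B →ₐ[k] C) (g : B →ₐ[k] A) : Submodule k (KerMod f ⊗[k] A) :=
  Submodule.span k
    {t | ∃ (n : KerMod f) (b : B) (a : A), t = kerMulRight f b n ⊗ₜ[k] a - n ⊗ₜ[k] (g b * a)}

/-- The tensor product `ker f ⊗_B A`, where `ker f` is a right `B`-module by multiplication and
`A` is a left `B`-module through `g : B → A`. -/
def KerTensor (f : B →ₐ[k] C) (g : B →ₐ[k] A) : Type _ :=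
  (KerMod f ⊗[k] A) ⧸ balancedRel f g

namespace KerTensor

variable (f : B →ₐ[k] C) (g : B →ₐ[k] A)

instance : AddCommGroup (KerTensor f g) :=
  inferInstanceAs (AddCommGroup ((KerMod f ⊗[k] A) ⧸ balancedRel f g))

instance : Module k (KerTensor f g) :=
  inferInstanceAs (Module k ((KerMod f ⊗[k] A) ⧸ balancedRel f g))

/-- The projection `ker f ⊗_k A → ker f ⊗_B A`. -/
def mk : KerMod f ⊗[k] A →ₗ[k] KerTensor f g := (balancedRel f g).mkQ

/-- The class `n ⊗ a` in `ker f ⊗_B A`. -/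
def tmul (n : KerMod f) (a : A) : KerTensor f g := mk f g (n ⊗ₜ[k] a)

theorem mk_surjective : Function.Surjective (mk f g) := (balancedRel f g).mkQ_surjective

theorem tmul_balanced (n : KerMod f) (b : B) (a : A) :
    tmul f g (kerMulRight f b n) a = tmul f g n (g b * a) :=
  (Submodule.Quotient.eq _).2 (Submodule.subset_span ⟨n, b, a, rfl⟩)

theorem hom_ext {P : Type*} [AddCommGroup P] [Module k P] {φ ψ : KerTensor f g →ₗ[k] P}
    (h : ∀ n a, φ (tmul f g n a) = ψ (tmul f g n a)) : φ = ψ := by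
  have : φ.comp (mk f g) = ψ.comp (mk f g) := TensorProduct.ext' h
  exact LinearMap.cancel_right (mk_surjective f g) |>.1 this

/-- The right action of `A` on `ker f ⊗_B A`: `(n ⊗ a) · c = n ⊗ a c`. -/
def rightActLin (c : A) : KerTensor f g →ₗ[k] KerTensor f g :=
  (balancedRel f g).mapQ (balancedRel f g) (LinearMap.lTensor _ (LinearMap.mulRight k c)) <| by
    refine Submodule.span_le.2 ?_
    rintro _ ⟨n, b, a, rfl⟩
    refine Submodule.subset_span ⟨n, b, a * c, ?_⟩
    simp [mul_assoc]

theorem rightActLin_tmul (c : A) (n : KerMod f) (a : A) :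
    rightActLin f g c (tmul f g n a) = tmul f g n (a * c) := rfl

/-- The right action of `A` on `ker f ⊗_B A`, as a morphism from the opposite algebra. -/
def rightAct : Aᵐᵒᵖ →ₐ[k] Module.End k (KerTensor f g) :=
  AlgHom.ofLinearMap
    { toFun := fun c => rightActLin f g c.unop
      map_add' := fun c d => hom_ext f g fun n a => by
        simp only [rightActLin_tmul, LinearMap.add_apply, unop_add, mul_add]
        simp only [tmul, TensorProduct.tmul_add, map_add]
      map_smul' := fun r c => hom_ext f g fun n a => by
        simp only [rightActLin_tmul, LinearMap.smul_apply, unop_smul, mul_smul_comm,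
          RingHom.id_apply]
        simp only [tmul, TensorProduct.tmul_smul, map_smul] }
    (hom_ext f g fun n a => by simp [rightActLin_tmul])
    (fun c d => hom_ext f g fun n a => by simp [rightActLin_tmul, mul_assoc])

/-- `ker f ⊗_B A` is a right `A`-module. -/
instance : Module Aᵐᵒᵖ (KerTensor f g) := Module.compHom _ (rightAct f g).toRingHom

theorem op_smul_tmul (c : A) (n : KerMod f) (a : A) :
    op c • tmul f g n a = tmul f g n (a * c) := rfl

instance : IsScalarTower k Aᵐᵒᵖ (KerTensor f g) :=
  ⟨fun r c m => by
    show rightAct f g (r • c) m = r • rightAct f g c m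
    rw [map_smul, LinearMap.smul_apply]⟩

instance : SMulCommClass Aᵐᵒᵖ k (KerTensor f g) :=
  ⟨fun c r m => (rightAct f g c).map_smul r m⟩

/-- Left multiplication by `b` on `ker f ⊗_B A`: `b · (n ⊗ a) = b n ⊗ a`. -/
def leftActLin (b : B) : KerTensor f g →ₗ[k] KerTensor f g :=
  (balancedRel f g).mapQ (balancedRel f g) (LinearMap.rTensor _ (kerMulLeft f b)) <| by
    refine Submodule.span_le.2 ?_
    rintro _ ⟨n, c, a, rfl⟩
    refine Submodule.subset_span ⟨kerMulLeft f b n, c, a, ?_⟩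
    have : kerMulLeft f b (kerMulRight f c n) = kerMulRight f c (kerMulLeft f b n) :=
      KerMod.ext (mul_assoc b _ c).symm
    simp [this]

theorem leftActLin_tmul (b : B) (n : KerMod f) (a : A) :
    leftActLin f g b (tmul f g n a) = tmul f g (kerMulLeft f b n) a := rfl

/-- The left action of `B` on the right `A`-module `ker f ⊗_B A`. -/
def leftAct : B →ₐ[k] Module.End Aᵐᵒᵖ (KerTensor f g) :=
  AlgHom.ofLinearMap
    { toFun := fun b =>
        { toFun := leftActLin f g b
          map_add' := (leftActLin f g b).map_add
          map_smul' := fun c m => by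
            have h : (leftActLin f g b).comp (rightAct f g c) =
                (rightAct f g c).comp (leftActLin f g b) := hom_ext f g fun n a => rfl
            exact LinearMap.congr_fun h m }
      map_add' := fun b c => by
        ext1 m
        have h : leftActLin f g (b + c) = leftActLin f g b + leftActLin f g c :=
          hom_ext f g fun n a => by
            simp only [leftActLin_tmul, LinearMap.add_apply, map_add]
            simp only [tmul, TensorProduct.add_tmul, map_add]
        exact LinearMap.congr_fun h m
      map_smul' := fun r b => by
        ext1 m
        have h : leftActLin f g (r • b) = r • leftActLin f g b :=
          hom_ext f g fun n a => by
            simp only [leftActLin_tmul, LinearMap.smul_apply, map_smul]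
            simp only [tmul, ← TensorProduct.smul_tmul', map_smul]
        exact LinearMap.congr_fun h m }
    (by
      ext1 m
      have h : leftActLin f g 1 = LinearMap.id :=
        hom_ext f g fun n a => by simp [leftActLin_tmul]
      exact LinearMap.congr_fun h m)
    (fun b c => by
      ext1 m
      have h : leftActLin f g (b * c) = (leftActLin f g b).comp (leftActLin f g c) :=
        hom_ext f g fun n a => by simp [leftActLin_tmul]
      exact LinearMap.congr_fun h m)

/-- The `k`-linear map `ker f → ker f ⊗_B A`, `n ↦ n ⊗ 1`. -/
def tmulOne : KerMod f →ₗ[k] KerTensor f g := (mk f g).comp ((TensorProduct.mk k _ A).flip 1)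

theorem tmulOne_apply (n : KerMod f) : tmulOne f g n = tmul f g n 1 := rfl

end KerTensor

end KerTensor

/-! ### The groups `K₄` and `P₅*` -/

/-- The generators of the pure braid group on four strands. -/
inductive Gen : Type
  | x12 | x13 | x14 | x23 | x24 | x34

/-- The generator `s` of the free group on `Gen`. -/
abbrev fg (s : Gen) : FreeGroup Gen := FreeGroup.of s

/-- The commutator `(g, h) = g h g⁻¹ h⁻¹`. -/
def comm (g h : FreeGroup Gen) : FreeGroup Gen := g * h * g⁻¹ * h⁻¹

/-- The relators `(abc, a)`, `(abc, b)`, `(abc, c)`. -/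
def tripleRels (a b c : Gen) : Set (FreeGroup Gen) :=
  {comm (fg a * fg b * fg c) (fg a), comm (fg a * fg b * fg c) (fg b), comm (fg a * fg b * fg c) (fg c)}

/-- The relators of `K₄`. -/
def K4Rels : Set (FreeGroup Gen) :=
  tripleRels .x12 .x13 .x23 ∪ tripleRels .x12 .x14 .x24 ∪ tripleRels .x13 .x14 .x34 ∪
    tripleRels .x23 .x24 .x34 ∪
    {comm (fg .x12) (fg .x34), comm (fg .x13) ((fg .x12)⁻¹ * fg .x24 * fg .x12), comm (fg .x14) (fg .x23)}

/-- The group `K₄`. -/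
abbrev K4 : Type := PresentedGroup K4Rels

/-- `P₅* = K₄ / Z(K₄)`. -/
abbrev P5 : Type := K4 ⧸ Subgroup.center K4

/-- The class in `P₅*` of a generator. -/
def P5.x (s : Gen) : P5 := QuotientGroup.mk (PresentedGroup.of s)

/-- The elements `x₁₅ = (x₁₂x₁₃x₁₄)⁻¹`, `x₂₅ = (x₁₂x₂₃x₂₄)⁻¹`, `x₃₅ = (x₁₃x₂₃x₃₄)⁻¹` of `P₅*`. -/
def P5.x5 : Fin 3 → P5 :=
  ![(P5.x .x12 * P5.x .x13 * P5.x .x14)⁻¹, (P5.x .x12 * P5.x .x23 * P5.x .x24)⁻¹,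
    (P5.x .x13 * P5.x .x23 * P5.x .x34)⁻¹]

/-- The centre of `F₂` is trivial. -/
theorem center_F2 (g : F2) (hg : ∀ h : F2, h * g = g * h) : g = 1 := by
  by_contra hne
  obtain ⟨⟨a, ε⟩, L, hL⟩ := List.exists_cons_of_ne_nil (mt FreeGroup.toWord_eq_nil_iff.1 hne)
  obtain ⟨b, hb⟩ := exists_ne a
  have hred : FreeGroup.IsReduced ((a, ε) :: L) := hL ▸ FreeGroup.isReduced_toWord
  have hred' : FreeGroup.IsReduced ((b, true) :: (a, ε) :: L) := by
    refine List.isChain_cons_cons.2 ⟨fun h => absurd h hb, hred⟩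
  have e1 : (FreeGroup.of b * g).toWord = (b, true) :: (a, ε) :: L := by
    rw [FreeGroup.toWord_mul, FreeGroup.toWord_of, hL]
    exact hred'.reduce_eq
  have e2 : (g * FreeGroup.of b).toWord = FreeGroup.reduce (((a, ε) :: L) ++ [(b, true)]) := by
    rw [FreeGroup.toWord_mul, FreeGroup.toWord_of, hL]
  rw [← hg, e1] at e2
  have hs : FreeGroup.reduce (((a, ε) :: L) ++ [(b, true)]) = ((a, ε) :: L) ++ [(b, true)] :=
    FreeGroup.reduce.red.sublist.eq_of_length (by rw [← e2]; simp)
  rw [hs] at e2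
  simp only [List.cons_append, List.cons.injEq, Prod.mk.injEq] at e2
  exact hb e2.1.1

/-- A surjective morphism `K₄ → F₂` kills the centre of `K₄`. -/
theorem center_le_ker (φ : K4 →* F2) (h0 : ∀ i, ∃ s, φ s = FreeGroup.of i) :
    Subgroup.center K4 ≤ φ.ker := by
  intro z hz
  have hsurj : φ.range = ⊤ := by
    rw [eq_top_iff, ← FreeGroup.closure_range_of, Subgroup.closure_le]
    rintro _ ⟨i, rfl⟩
    exact h0 i
  refine center_F2 (φ z) fun h => ?_
  obtain ⟨y, rfl⟩ := MonoidHom.range_eq_top.1 hsurj h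
  rw [← map_mul, ← map_mul, Subgroup.mem_center_iff.1 hz y]

/-- The morphism `P₅* → F₂` induced by `v : Gen → F₂`. -/
def P5.lift (v : Gen → F2) (hv : ∀ r ∈ K4Rels, FreeGroup.lift v r = 1)
    (h0 : ∀ i, ∃ s, v s = FreeGroup.of i) : P5 →* F2 :=
  QuotientGroup.lift (Subgroup.center K4) (PresentedGroup.toGroup hv)
    (fun _ hz => center_le_ker (PresentedGroup.toGroup hv)
      (fun i => (h0 i).imp' PresentedGroup.of fun s hs => by
        rw [PresentedGroup.toGroup.of, hs]) hz)

theorem P5.lift_x (v : Gen → F2) (hv h0) (s : Gen) : P5.lift v hv h0 (P5.x s) = v s :=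
  PresentedGroup.toGroup.of hv

/-- `X₀` in `F₂`. -/
abbrev X0 : F2 := FreeGroup.of 0
/-- `X₁` in `F₂`. -/
abbrev X1 : F2 := FreeGroup.of 1

/-- Values of `pr₁` on generators. -/
def pr1Val : Gen → F2
  | .x12 => 1
  | .x13 => 1
  | .x14 => 1
  | .x23 => X0
  | .x24 => (X1 * X0)⁻¹
  | .x34 => X1

/-- Values of `pr₂` on generators. -/
def pr2Val : Gen → F2
  | .x12 => 1
  | .x13 => (X0 * X1)⁻¹
  | .x14 => X0
  | .x23 => 1
  | .x24 => 1
  | .x34 => X1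

/-- Values of `pr₅` on generators. -/
def pr5Val : Gen → F2
  | .x12 => X1
  | .x13 => (X0 * X1)⁻¹
  | .x14 => X0
  | .x23 => X0
  | .x24 => (X1 * X0)⁻¹
  | .x34 => X1

theorem pr1Val_rels : ∀ r ∈ K4Rels, FreeGroup.lift pr1Val r = 1 := by
  simp only [K4Rels, tripleRels, Set.mem_union, Set.mem_insert_iff, Set.mem_singleton_iff]
  rintro r (((((h | h | h) | h | h | h) | h | h | h) | h | h | h) | h | h | h) <;> subst h <;>
    simp [comm, pr1Val, mul_assoc]

theorem pr2Val_rels : ∀ r ∈ K4Rels, FreeGroup.lift pr2Val r = 1 := by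
  simp only [K4Rels, tripleRels, Set.mem_union, Set.mem_insert_iff, Set.mem_singleton_iff]
  rintro r (((((h | h | h) | h | h | h) | h | h | h) | h | h | h) | h | h | h) <;> subst h <;>
    simp [comm, pr2Val, mul_assoc]

theorem pr5Val_rels : ∀ r ∈ K4Rels, FreeGroup.lift pr5Val r = 1 := by
  simp only [K4Rels, tripleRels, Set.mem_union, Set.mem_insert_iff, Set.mem_singleton_iff]
  rintro r (((((h | h | h) | h | h | h) | h | h | h) | h | h | h) | h | h | h) <;> subst h <;>
    simp [comm, pr5Val, mul_assoc]

/-- The group morphism `pr₁ : P₅* → F₂`. -/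
def pr1 : P5 →* F2 := P5.lift pr1Val pr1Val_rels (by
  intro i; fin_cases i; exacts [⟨.x23, rfl⟩, ⟨.x34, rfl⟩])

/-- The group morphism `pr₂ : P₅* → F₂`. -/
def pr2 : P5 →* F2 := P5.lift pr2Val pr2Val_rels (by
  intro i; fin_cases i; exacts [⟨.x14, rfl⟩, ⟨.x34, rfl⟩])

/-- The group morphism `pr₅ : P₅* → F₂`. -/
def pr5 : P5 →* F2 := P5.lift pr5Val pr5Val_rels (by
  intro i; fin_cases i; exacts [⟨.x23, rfl⟩, ⟨.x12, rfl⟩])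

/-- The group morphism `ℓ : F₂ → P₅*` with `X₀ ↦ x₂₃` and `X₁ ↦ x₁₂`. -/
def ell : F2 →* P5 := FreeGroup.lift ![P5.x .x23, P5.x .x12]

/-! ### The bimodule `M` -/

section MB

variable (k : Type*) [CommRing k]

/-- The algebra morphism `k pr₁₂ : k P₅* → V ⊗ V`, given on `p ∈ P₅*` by `pr₁(p) ⊗ pr₂(p)`. -/
def kpr12 : MonoidAlgebra k P5 →ₐ[k] VV k :=
  MonoidAlgebra.lift k (VV k) P5
    { toFun := fun p => MonoidAlgebra.of k F2 (pr1 p) ⊗ₜ[k] MonoidAlgebra.of k F2 (pr2 p)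
      map_one' := by rw [map_one, map_one, map_one, map_one, Algebra.TensorProduct.one_def]
      map_mul' := fun p q => by
        rw [Algebra.TensorProduct.tmul_mul_tmul, map_mul, map_mul, map_mul, map_mul] }

/-- The algebra morphism `k pr₅ : k P₅* → V`. -/
abbrev kpr5 : MonoidAlgebra k P5 →ₐ[k] VB k := groupAlgMap k pr5

/-- The algebra morphism `k ℓ : V → k P₅*`. -/
abbrev kell : VB k →ₐ[k] MonoidAlgebra k P5 := groupAlgMap k ell

/-- `M = ker(k pr₅) ⊗_{k P₅*} (V ⊗ V)`. -/
abbrev MB : Type _ := KerTensor (kpr5 k) (kpr12 k)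

/-- The left action `rρ` (bold) of `V` on the right `V ⊗ V`-module `M`:
`v ↦ (p ⊗ w ↦ ℓ(v) p ⊗ w)`. -/
def rRhoBold : VB k →ₐ[k] Module.End (VV k)ᵐᵒᵖ (MB k) :=
  (KerTensor.leftAct (kpr5 k) (kpr12 k)).comp (kell k)

theorem pr5_x5 (i : Fin 3) : pr5 (P5.x5 i) = 1 := by
  fin_cases i <;> simp [P5.x5, pr5, P5.lift_x, pr5Val]

/-- The element `x_{i5} - 1` of `ker(k pr₅)`. -/
def x5SubOne (i : Fin 3) : KerMod (kpr5 k) :=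
  KerMod.of (kpr5 k) (MonoidAlgebra.of k P5 (P5.x5 i) - 1) (by
    rw [map_sub, map_one, groupAlgMap_of, pr5_x5, map_one, sub_self])

/-- The filtration of `ker(k pr₅)` induced by that of `k P₅*`: `Fⁿ(k P₅*) ∩ ker(k pr₅)`. -/
def filKer (n : ℤ) : Submodule k (KerMod (kpr5 k)) :=
  (augFil k P5 n).comap (KerMod.incl (kpr5 k))

/-- The filtration of `M`: the image of `Fⁿ ker(k pr₅)` under `x ↦ x ⊗ 1`. -/
def filMB (n : ℤ) : Submodule k (MB k) :=
  (filKer k n).map (KerTensor.tmulOne (kpr5 k) (kpr12 k))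

end MB

/-! ### Filtered bimodules -/

/-- `FM` makes the bimodule `(B, M, A, ρ)` a filtered bimodule over the filtered algebras
`(B, FB)` and `(A, FA)`: it is decreasing, and compatible with the right action of `A` and with
the left action `ρ` of `B`. -/
structure IsFilteredBimodule {k B A M : Type*} [CommRing k] [Ring B] [Algebra k B] [Ring A]
    [Algebra k A] [AddCommGroup M] [Module k M] [Module Aᵐᵒᵖ M] [IsScalarTower k Aᵐᵒᵖ M]
    [SMulCommClass Aᵐᵒᵖ k M] (ρ : B →ₐ[k] Module.End Aᵐᵒᵖ M)
    (FB : ℤ → Submodule k B) (FA : ℤ → Submodule k A) (FM : ℤ → Submodule k M) : Prop where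
  antitone : Antitone FM
  smul_mem : ∀ (m n : ℤ) (x : M) (a : A), x ∈ FM m → a ∈ FA n → op a • x ∈ FM (m + n)
  act_mem : ∀ (m n : ℤ) (b : B) (x : M), b ∈ FB m → x ∈ FM n → ρ b x ∈ FM (m + n)

end BettiBimodule

end

/-!
Write `G = P₅*` and `x = x₁₅`, `y = x₂₅`, `z = x₃₅`.  The map `pr₅ : G → F₂` is split by `ℓ`, and its
kernel is free on `x`, `y`, `z`; hence `ker(k pr₅)` is a free right `k G`-module with basis
`x - 1`, `y - 1`, `z - 1`, which makes `Φ` bijective.  The proof does not identify `G` with a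
semidirect product; it establishes separately that the three elements generate and that they are
independent over `V ⊗ V`.

*Generation.*  The full twist is central in `K₄` (`PureBraid.commute_fullTwist`), hence trivial in
`G`.  From this, `x₂₃` commutes with `x`, `x₁₂` commutes with `z`, and `x₁₂`, `x₂₃` act on the pairs
`(x, y)`, `(y, z)` by conjugation with `(x y)⁻¹`, `(y z)⁻¹` (`PureBraid.fiberRel`).  So `x`, `y`, `z`
generate a normal subgroup `N`, with `g ∈ N ℓ(pr₅ g)` for all `g` (`P5.mul_inv_ell_pr5_mem`), and
`ker(k pr₅)` is the right ideal generated by `x - 1`, `y - 1`, `z - 1`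
(`sub_kell_kpr5_mem_x5Ideal`).

*Independence.*  A left inverse of `Φ` comes from a Fox derivative `D : k G → (V ⊗ V)³`, satisfying
`D(p q) = D(p) pr₁₂(q) + rρ(pr₅ p) D(q)`, `D(x_{i5} - 1) = e_i` and `D ∘ ℓ = 0`.  Such a `D` is the
off-diagonal block of a morphism from `G` to block triangular matrices with diagonal blocks
`rρ(pr₅ g)` and `pr₁₂(g)`.  To construct it, note that the relations of `K₄` follow from the action of
`x₁₂`, `x₂₃` on `x`, `y`, `z` described above (`FiberRel.pureBraid`), so that only these six relations
have to be checked on matrices (`TriMat.fiberRel`); this is where the explicit `rρ` enters.  The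
morphism kills the centre of `K₄`, because right multiplication by `Y₁ - 1` is injective on `V ⊗ V`
(`center_le_ker_triK4`).

Since `D` restricted to `ker(k pr₅)` is `k G`-linear on the right and `rρ`-equivariant on the left, the
resulting inverse of `Φ`, and hence `Φ`, is a morphism of bimodules.  For the filtrations,
`D(Iⁿ) ⊆ Fⁿ⁻¹` follows from the Leibniz rule by induction, and the other inclusion from
`Fⁿ⁻¹(V ⊗ V) = pr₁₂(Fⁿ⁻¹ k G)`, as `(x_{i5} - 1) ⊗ pr₁₂(b) = (x_{i5} - 1) b ⊗ 1`.
-/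


noncomputable section

namespace BettiBimodule

/-! ### The relations of `K₄` and the action on the fibre -/

/-- The relations of `K₄`, for a family `v` of elements of a group. -/
structure PureBraid {H : Type*} [Group H] (v : Gen → H) : Prop where
  r123_12 : Commute (v .x12 * v .x13 * v .x23) (v .x12)
  r123_13 : Commute (v .x12 * v .x13 * v .x23) (v .x13)
  r123_23 : Commute (v .x12 * v .x13 * v .x23) (v .x23)
  r124_12 : Commute (v .x12 * v .x14 * v .x24) (v .x12)
  r124_14 : Commute (v .x12 * v .x14 * v .x24) (v .x14)
  r124_24 : Commute (v .x12 * v .x14 * v .x24) (v .x24)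
  r134_13 : Commute (v .x13 * v .x14 * v .x34) (v .x13)
  r134_14 : Commute (v .x13 * v .x14 * v .x34) (v .x14)
  r134_34 : Commute (v .x13 * v .x14 * v .x34) (v .x34)
  r234_23 : Commute (v .x23 * v .x24 * v .x34) (v .x23)
  r234_24 : Commute (v .x23 * v .x24 * v .x34) (v .x24)
  r234_34 : Commute (v .x23 * v .x24 * v .x34) (v .x34)
  r12_34 : Commute (v .x12) (v .x34)
  r13_24 : Commute (v .x13) ((v .x12)⁻¹ * v .x24 * v .x12)
  r14_23 : Commute (v .x14) (v .x23)

theorem lift_comm_eq_one_iff {H : Type*} [Group H] (v : Gen → H) (g h : FreeGroup Gen) :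
    FreeGroup.lift v (comm g h) = 1 ↔ Commute (FreeGroup.lift v g) (FreeGroup.lift v h) := by
  simp only [comm, map_mul, map_inv, mul_inv_eq_iff_eq_mul, Commute, SemiconjBy, one_mul]

theorem lift_K4Rels_iff {H : Type*} [Group H] (v : Gen → H) :
    (∀ r ∈ K4Rels, FreeGroup.lift v r = 1) ↔ PureBraid v := by
  simp only [K4Rels, tripleRels, Set.mem_union, Set.mem_insert_iff, Set.mem_singleton_iff,
    or_imp, forall_and, forall_eq, lift_comm_eq_one_iff, map_mul, map_inv, FreeGroup.lift_apply_of]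
  constructor
  · rintro ⟨⟨⟨⟨⟨h1, h2, h3⟩, h4, h5, h6⟩, h7, h8, h9⟩, h10, h11, h12⟩, h13, h14, h15⟩
    exact ⟨h1, h2, h3, h4, h5, h6, h7, h8, h9, h10, h11, h12, h13, h14, h15⟩
  · rintro ⟨h1, h2, h3, h4, h5, h6, h7, h8, h9, h10, h11, h12, h13, h14, h15⟩
    exact ⟨⟨⟨⟨⟨h1, h2, h3⟩, h4, h5, h6⟩, h7, h8, h9⟩, h10, h11, h12⟩, h13, h14, h15⟩

/-- The relations of the semidirect product in which `a` and `d` act on the group generated by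
`x`, `y`, `z`: conjugation by `a` fixes `z` and agrees with conjugation by `(x y)⁻¹` on `x` and `y`;
conjugation by `d` fixes `x` and agrees with conjugation by `(y z)⁻¹` on `y` and `z`.  They hold in
`P₅*` for `a = x₁₂`, `d = x₂₃`, `x = x₁₅`, `y = x₂₅`, `z = x₃₅`. -/
structure FiberRel {H : Type*} [Group H] (a d x y z : H) : Prop where
  az : Commute a z
  dx : Commute d x
  xya_x : Commute (x * y * a) x
  xya_y : Commute (x * y * a) y
  yzd_y : Commute (y * z * d) y
  yzd_z : Commute (y * z * d) z

/-- The generators of `P₅*` as words in `a = x₁₂`, `d = x₂₃`, `x = x₁₅`, `y = x₂₅`, `z = x₃₅`. They are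
found by solving for `x₁₄`, `x₂₄` and `x₁₃` in the definitions of `x₁₅`, `x₂₅` and `x₃₅`; the value of
`x₃₄` is `PureBraid.x34_eq`. -/
def fiberVal {H : Type*} [Group H] (a d x y z : H) : Gen → H
  | .x12 => a
  | .x13 => z⁻¹ * (a * x * y)⁻¹ * d⁻¹
  | .x14 => (a * (z⁻¹ * (a * x * y)⁻¹ * d⁻¹))⁻¹ * x⁻¹
  | .x23 => d
  | .x24 => (a * d)⁻¹ * y⁻¹
  | .x34 => a * x * y

/-- Consequences of `a x = w a` for rewriting: they move `a` to the right past `x` and `x⁻¹` in a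
right-associated product. -/
theorem push_rules {H : Type*} [Group H] {a x w : H} (h : a * x = w * a) :
    (∀ t, a * (x * t) = w * (a * t)) ∧ (a * x⁻¹ = w⁻¹ * a) ∧ (∀ t, a * (x⁻¹ * t) = w⁻¹ * (a * t)) := by
  have h' : a * x⁻¹ = w⁻¹ * a := by
    rw [eq_inv_mul_iff_mul_eq, ← mul_assoc, ← h, mul_inv_cancel_right]
  refine ⟨fun t => ?_, h', fun t => ?_⟩
  · rw [← mul_assoc, h, mul_assoc]
  · rw [← mul_assoc, h', mul_assoc]

namespace FiberRel

variable {H : Type*} [Group H] {a d x y z : H}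

theorem ax (h : FiberRel a d x y z) : a * x = y⁻¹ * x * y * a := by
  have := h.xya_x.eq
  simp only [mul_assoc, mul_right_inj] at this
  simp only [mul_assoc, ← this, inv_mul_cancel_left]

theorem ay (h : FiberRel a d x y z) : a * y = y⁻¹ * x⁻¹ * y * x * y * a := by
  have := h.xya_y.eq
  simp only [mul_assoc] at this
  simp only [mul_assoc, ← this, inv_mul_cancel_left]

theorem dy (h : FiberRel a d x y z) : d * y = z⁻¹ * y * z * d := by
  have := h.yzd_y.eq
  simp only [mul_assoc, mul_right_inj] at this
  simp only [mul_assoc, ← this, inv_mul_cancel_left]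

theorem dz (h : FiberRel a d x y z) : d * z = z⁻¹ * y⁻¹ * z * y * z * d := by
  have := h.yzd_z.eq
  simp only [mul_assoc] at this
  simp only [mul_assoc, ← this, inv_mul_cancel_left]

theorem inv_ax (h : FiberRel a d x y z) : a⁻¹ * x = x * y * x * y⁻¹ * x⁻¹ * a⁻¹ := by
  rw [inv_mul_eq_iff_eq_mul]
  simp only [mul_assoc, push_rules h.ax, push_rules h.ay]
  group

theorem inv_ay (h : FiberRel a d x y z) : a⁻¹ * y = x * y * x⁻¹ * a⁻¹ := by
  rw [inv_mul_eq_iff_eq_mul]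
  simp only [mul_assoc, push_rules h.ax, push_rules h.ay]
  group

theorem inv_dy (h : FiberRel a d x y z) : d⁻¹ * y = y * z * y * z⁻¹ * y⁻¹ * d⁻¹ := by
  rw [inv_mul_eq_iff_eq_mul]
  simp only [mul_assoc, push_rules h.dy, push_rules h.dz]
  group

theorem inv_dz (h : FiberRel a d x y z) : d⁻¹ * z = y * z * y⁻¹ * d⁻¹ := by
  rw [inv_mul_eq_iff_eq_mul]
  simp only [mul_assoc, push_rules h.dy, push_rules h.dz]
  group

/-- The relations of `K₄` follow from those of the semidirect product: moving `a` and `d` to the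
right and reducing freely gives the same normal form for both sides of every relation. -/
theorem pureBraid (h : FiberRel a d x y z) : PureBraid (fiberVal a d x y z) := by
  constructor <;> simp only [fiberVal, Commute, SemiconjBy]
  all_goals
    simp only [mul_inv_rev, inv_inv, mul_assoc, mul_inv_cancel_left, inv_mul_cancel_left,
      mul_inv_cancel, inv_mul_cancel, mul_one, h.ax, h.ay, h.dx.eq, h.dy, h.dz,
      push_rules h.ax, push_rules h.ay, push_rules h.az.eq, push_rules h.dx.eq, push_rules h.dy,
      push_rules h.dz, h.inv_ax, push_rules h.inv_ax, push_rules h.inv_ay,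
      push_rules h.az.inv_left.eq, push_rules h.dx.inv_left.eq, push_rules h.inv_dy,
      push_rules h.inv_dz]

end FiberRel

section Commute

variable {H : Type*} [Group H] {p q r : H}

theorem commute_tail (h : Commute (p * q * r) p) : Commute (q * r) p := by
  have := h.eq
  simp only [mul_assoc, mul_right_inj] at this
  simpa only [Commute, SemiconjBy, mul_assoc] using this

theorem commute_init (h : Commute (p * q * r) r) : Commute (p * q) r := by
  have := h.eq
  simp only [← mul_assoc, mul_left_inj] at this
  simpa only [Commute, SemiconjBy, ← mul_assoc] using this

theorem commute_rotate (h : Commute (p * q * r) p) (h' : Commute (p * q * r) q) :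
    Commute (r * p) q := by
  refine commute_tail (p := q) ?_
  have : q * r * p = p * q * r := by rw [(commute_tail h).eq, mul_assoc]
  rw [this]
  exact h'

end Commute

namespace PureBraid

variable {H : Type*} [Group H] {v : Gen → H}

/-- The full twist `x₁₂ x₁₃ x₂₃ x₁₄ x₂₄ x₃₄` is central. -/
theorem commute_fullTwist (h : PureBraid v) (s : Gen) :
    Commute (v .x12 * v .x13 * v .x23 * (v .x14 * v .x24 * v .x34)) (v s) := by
  obtain ⟨h1, h2, h3, h4, h5, h6, h7, h8, h9, h10, h11, h12, h13, h14, h15⟩ := h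
  generalize hA : v .x12 = a at *
  generalize hB : v .x13 = b at *
  generalize hC : v .x14 = c at *
  generalize hD : v .x23 = d at *
  generalize hE : v .x24 = e at *
  generalize hF : v .x34 = f at *
  cases s
  · rw [hA]
    have : a * b * d * (c * e * f) = a * (b * d) * (c * e) * f := by group
    rw [this]
    exact (((Commute.refl a).mul_left (commute_tail h1)).mul_left (commute_tail h4)).mul_left
      h13.symm
  · rw [hB]
    have e1 : c * e = a⁻¹ * e * a * c := by
      have := (commute_init h6).eq
      rw [mul_assoc, ← eq_inv_mul_iff_mul_eq] at this
      rw [this]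
      group
    have : c * e * f = a⁻¹ * e * a * (c * f) := by rw [e1]; group
    rw [this]
    exact h2.mul_left (h14.symm.mul_left (commute_tail h7))
  · rw [hC]
    have e0 : Commute (a * b * d * (c * e * f)) a := by
      have : a * b * d * (c * e * f) = a * (b * d) * (c * e) * f := by group
      rw [this]
      exact (((Commute.refl a).mul_left (commute_tail h1)).mul_left (commute_tail h4)).mul_left
        h13.symm
    -- conjugating by `a` moves it to the end of the word
    have e1 : a * b * d * (c * e * f) = b * c * f * d * (e * a) := by
      have e2 : a * (a * b * d * (c * e * f)) = a * (b * c * f * d * (e * a)) := by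
        rw [← e0.eq]
        calc _ = a * b * (d * c) * e * f * a := by group
          _ = a * b * c * (d * e * f) * a := by rw [← h15.eq]; group
          _ = _ := by rw [(commute_init h12).eq]; group
      exact mul_left_cancel e2
    rw [e1]
    exact (h8.mul_left h15.symm).mul_left (commute_rotate h4 h5)
  · rw [hD]
    rw [mul_assoc c]
    exact h3.mul_left (h15.mul_left (commute_tail h10))
  · rw [hE]
    have e1 : a * b * d * (c * e * f) = (a * b * a⁻¹) * (a * c) * (d * e * f) := by
      calc _ = a * b * (d * c) * e * f := by group
          _ = _ := by rw [← h15.eq]; group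
    have e2 : Commute (a * b * a⁻¹) e := by
      rw [← Commute.conj_iff a⁻¹]
      convert h14 using 1 <;> group
    rw [e1]
    exact (e2.mul_left (commute_init h6)).mul_left h11
  · rw [hF]
    have e1 : a * b * d * (c * e * f) = a * (b * c) * (d * e) * f := by
      calc _ = a * b * (d * c) * e * f := by group
          _ = _ := by rw [← h15.eq]; group
    rw [e1]
    exact ((h13.mul_left (commute_init h9)).mul_left (commute_init h12)).mul_left (Commute.refl f)

/-- If the full twist is trivial, then `x₃₄ = x₁₂ x₁₅ x₂₅`. -/
theorem x34_eq (h : PureBraid v)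
    (h0 : v .x12 * v .x13 * v .x23 * (v .x14 * v .x24 * v .x34) = 1) :
    v .x34 = v .x12 * (v .x12 * v .x13 * v .x14)⁻¹ * (v .x12 * v .x23 * v .x24)⁻¹ := by
  obtain ⟨h1, h2, h3, h4, h5, h6, h7, h8, h9, h10, h11, h12, h13, h14, h15⟩ := h
  generalize v .x12 = a at *
  generalize v .x13 = b at *
  generalize v .x14 = c at *
  generalize v .x23 = d at *
  generalize v .x24 = e at *
  generalize v .x34 = f at *
  have e1 : e * a * b = a * b * a⁻¹ * e * a := by
    have := h14.eq
    calc _ = a * ((a⁻¹ * e * a) * b) := by group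
      _ = _ := by rw [← this]; group
  have e2 : a * (d * a * b) = a * b * d * a := by
    rw [mul_assoc d, ← (commute_init h3).eq, h1.eq]
  have e3 : a * b * d = f⁻¹ * e⁻¹ * c⁻¹ := by
    rw [eq_inv_of_mul_eq_one_left h0]; group
  have e4 : a * d * e * (a * b * c) = f⁻¹ * a := by
    calc _ = a * d * (e * a * b) * c := by group
      _ = (a * (d * a * b)) * a⁻¹ * e * a * c := by rw [e1]; group
      _ = f⁻¹ * e⁻¹ * c⁻¹ * (e * a * c) := by rw [e2, e3]; group
      _ = f⁻¹ * a := by rw [(commute_rotate h4 h5).eq]; group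
  rw [mul_assoc a, ← mul_inv_rev, eq_mul_inv_iff_mul_eq]
  rw [e4, mul_inv_cancel_left]

/-- If the full twist is trivial, then `x₁₂` and `x₂₃` act on `x₁₅`, `x₂₅`, `x₃₅` as stated in
`FiberRel`.  The reason is that `x₁₅ x₂₅ x₁₂` equals `x₃₄`, which commutes with `x₁₅` and `x₂₅`, and
that `x₂₅ x₃₅ x₂₃` is a conjugate of `x₁₄` which commutes with `x₂₅` and `x₃₅`. -/
theorem fiberRel (h : PureBraid v)
    (h0 : v .x12 * v .x13 * v .x23 * (v .x14 * v .x24 * v .x34) = 1) :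
    FiberRel (v .x12) (v .x23) (v .x12 * v .x13 * v .x14)⁻¹ (v .x12 * v .x23 * v .x24)⁻¹
      (v .x13 * v .x23 * v .x34)⁻¹ := by
  have hf := h.x34_eq h0
  obtain ⟨h1, h2, h3, h4, h5, h6, h7, h8, h9, h10, h11, h12, h13, h14, h15⟩ := h
  generalize v .x12 = a at *
  generalize v .x13 = b at *
  generalize v .x14 = c at *
  generalize v .x23 = d at *
  generalize v .x24 = e at *
  generalize v .x34 = f at *
  have hfx : Commute f (a * b * c)⁻¹ := by
    rw [mul_assoc]
    exact (h13.symm.mul_right (commute_init h9).symm).inv_right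
  have hfy : Commute f (a * d * e)⁻¹ := by
    rw [mul_assoc]
    exact (h13.symm.mul_right (commute_init h12).symm).inv_right
  have hxya : (a * b * c)⁻¹ * (a * d * e)⁻¹ * a = f := by
    have : (a * b * c)⁻¹ * (a * d * e)⁻¹ = a⁻¹ * f := by rw [hf]; group
    rw [this, mul_assoc, ← h13.eq, inv_mul_cancel_left]
  have ht : a * b * d = (c * e * f)⁻¹ := eq_inv_of_mul_eq_one_left h0
  -- `(e f)⁻¹ c (e f)` is the conjugate of `x₁₄` which equals `y z d`
  have hcd : Commute ((e * f)⁻¹ * c * (e * f)) d :=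
    ((commute_tail h10).inv_left.mul_left h15).mul_left (commute_tail h10)
  have hyzd : (a * d * e)⁻¹ * (b * d * f)⁻¹ * d = (e * f)⁻¹ * c * (e * f) := by
    have hzy : b * d * f * (a * d * e) = (e * f)⁻¹ * c⁻¹ * (e * f) * d := by
      calc _ = b * d * (f * a) * (d * e) := by group
        _ = (b * d * a) * (f * (d * e)) := by rw [← h13.eq]; group
        _ = (a * b * d) * (d * (e * f)) := by
          rw [(commute_tail h1).eq, ← (commute_init h12).eq]; group
        _ = _ := by rw [ht, ← (commute_tail h10).eq]; group
    rw [← mul_inv_rev, hzy]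
    calc _ = d⁻¹ * ((e * f)⁻¹ * c * (e * f) * d) := by group
      _ = _ := by rw [hcd.eq]; group
  have hcz : Commute ((e * f)⁻¹ * c * (e * f)) (b * d * f)⁻¹ := by
    have hc : (e * f)⁻¹ * c * (e * f) = (a * b * d * (e * f))⁻¹ := by rw [ht]; group
    have hz : (b * d * f)⁻¹ = f⁻¹ * a * (a * b * d)⁻¹ := by
      rw [mul_assoc a, ← (commute_tail h1).eq]; group
    rw [hc, hz, Commute.inv_left_iff]
    calc a * b * d * (e * f) * (f⁻¹ * a * (a * b * d)⁻¹)
        = (a * b * d) * (e * a) * (a * b * d)⁻¹ := by group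
      _ = (e * f)⁻¹ * c⁻¹ * (e * a * c) * (e * f) := by rw [ht]; group
      _ = f⁻¹ * a * (e * f) := by rw [(commute_rotate h4 h5).eq]; group
      _ = _ := by group
  refine ⟨?_, ?_, ?_, ?_, ?_, ?_⟩
  · exact ((commute_tail h1).symm.mul_right h13).inv_right
  · exact ((commute_init h3).symm.mul_right h15.symm).inv_right
  · rw [hxya]; exact hfx
  · rw [hxya]; exact hfy
  · rw [hyzd]
    have : (a * d * e)⁻¹ = (e * f)⁻¹ * c * (e * f) * d⁻¹ * (b * d * f) := by
      rw [← hyzd]; group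
    rw [this]
    exact ((Commute.refl _).mul_right hcd.inv_right).mul_right (by simpa using hcz.inv_right)
  · rw [hyzd]; exact hcz

theorem eq_fiberVal (h : PureBraid v)
    (h0 : v .x12 * v .x13 * v .x23 * (v .x14 * v .x24 * v .x34) = 1) :
    v = fiberVal (v .x12) (v .x23) (v .x12 * v .x13 * v .x14)⁻¹ (v .x12 * v .x23 * v .x24)⁻¹
      (v .x13 * v .x23 * v .x34)⁻¹ := by
  have hf := h.x34_eq h0
  have h13 : v .x13 = (v .x13 * v .x23 * v .x34)⁻¹⁻¹ * (v .x34)⁻¹ * (v .x23)⁻¹ := by group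
  funext s
  cases s
  case x34 => exact hf
  case x13 => simpa only [fiberVal, ← hf] using h13
  case x14 => simp only [fiberVal, ← hf]; rw [← h13]; group
  all_goals simp only [fiberVal]
  group

end PureBraid

/-! ### The fibre of `pr₅` -/

/-- It suffices to test membership in the normalizer of a generated subgroup on the generators, for
the element and its inverse. -/
theorem mem_normalizer_closure {H : Type*} [Group H] {S : Set H} {g : H}
    (h : ∀ s ∈ S, g * s * g⁻¹ ∈ Subgroup.closure S)
    (h' : ∀ s ∈ S, g⁻¹ * s * g ∈ Subgroup.closure S) :
    g ∈ Subgroup.normalizer (Subgroup.closure S : Set H) := by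
  have key : ∀ g : H, (∀ s ∈ S, g * s * g⁻¹ ∈ Subgroup.closure S) →
      ∀ n ∈ Subgroup.closure S, g * n * g⁻¹ ∈ Subgroup.closure S := fun g h n hn => by
    have : Subgroup.closure S ≤ (Subgroup.closure S).comap (MulAut.conj g).toMonoidHom := by
      rw [Subgroup.closure_le]
      exact h
    exact this hn
  refine Subgroup.mem_normalizer_iff.2 fun n => ⟨key g h n, fun hn => ?_⟩
  have := key g⁻¹ (by simpa using h') _ hn
  simpa [mul_assoc] using this

namespace FiberRel

variable {H : Type*} [Group H] {a d x y z : H}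

theorem normal (h : FiberRel a d x y z) (hgen : Subgroup.closure {a, d, x, y, z} = ⊤) :
    (Subgroup.closure {x, y, z}).Normal := by
  set N := Subgroup.closure {x, y, z}
  have hx : x ∈ N := Subgroup.subset_closure (by simp)
  have hy : y ∈ N := Subgroup.subset_closure (by simp)
  have hz : z ∈ N := Subgroup.subset_closure (by simp)
  have hx' := inv_mem hx
  have hy' := inv_mem hy
  have hz' := inv_mem hz
  rw [← Subgroup.normalizer_eq_top_iff, eq_top_iff, ← hgen, Subgroup.closure_le]
  have hN := Subgroup.le_normalizer (H := N)
  rintro g (rfl | rfl | rfl | rfl | rfl)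
  · refine mem_normalizer_closure ?_ ?_ <;> rintro s (rfl | rfl | rfl)
    · rw [h.ax, mul_inv_cancel_right]; repeat' first | assumption | apply N.mul_mem
    · rw [h.ay, mul_inv_cancel_right]; repeat' first | assumption | apply N.mul_mem
    · rw [h.az.eq, mul_inv_cancel_right]; exact hz
    · rw [h.inv_ax, inv_mul_cancel_right]; repeat' first | assumption | apply N.mul_mem
    · rw [h.inv_ay, inv_mul_cancel_right]; repeat' first | assumption | apply N.mul_mem
    · rw [h.az.inv_left.eq, inv_mul_cancel_right]; exact hz
  · refine mem_normalizer_closure ?_ ?_ <;> rintro s (rfl | rfl | rfl)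
    · rw [h.dx.eq, mul_inv_cancel_right]; exact hx
    · rw [h.dy, mul_inv_cancel_right]; repeat' first | assumption | apply N.mul_mem
    · rw [h.dz, mul_inv_cancel_right]; repeat' first | assumption | apply N.mul_mem
    · rw [h.dx.inv_left.eq, inv_mul_cancel_right]; exact hx
    · rw [h.inv_dy, inv_mul_cancel_right]; repeat' first | assumption | apply N.mul_mem
    · rw [h.inv_dz, inv_mul_cancel_right]; repeat' first | assumption | apply N.mul_mem
  · exact hN hx
  · exact hN hy
  · exact hN hz

end FiberRel

theorem K4.hom_pureBraid {H : Type*} [Group H] (φ : K4 →* H) :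
    PureBraid (fun s => φ (PresentedGroup.of s)) := by
  rw [← lift_K4Rels_iff]
  intro r hr
  have : FreeGroup.lift (fun s => φ (PresentedGroup.of s : K4)) =
      φ.comp (PresentedGroup.mk K4Rels) :=
    FreeGroup.ext_hom _ _ fun s => by simp [PresentedGroup.of]
  rw [this, MonoidHom.comp_apply, PresentedGroup.one_of_mem hr, map_one]

theorem K4.pureBraid : PureBraid (fun s => (PresentedGroup.of s : K4)) :=
  K4.hom_pureBraid (MonoidHom.id K4)

theorem P5.pureBraid : PureBraid P5.x :=
  K4.hom_pureBraid (QuotientGroup.mk' (Subgroup.center K4))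

theorem P5.fullTwist_eq_one :
    P5.x .x12 * P5.x .x13 * P5.x .x23 * (P5.x .x14 * P5.x .x24 * P5.x .x34) = 1 := by
  refine (QuotientGroup.eq_one_iff (N := Subgroup.center K4) (.of .x12 * .of .x13 * .of .x23 *
    (.of .x14 * .of .x24 * .of .x34) : K4)).2 ?_
  refine Subgroup.mem_center_iff.2 fun g => ?_
  have := PresentedGroup.generated_by K4Rels (Subgroup.centralizer {(.of .x12 * .of .x13 *
    .of .x23 * (.of .x14 * .of .x24 * .of .x34) : K4)}) (fun s => by
      rw [Subgroup.mem_centralizer_singleton_iff]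
      exact (K4.pureBraid.commute_fullTwist s).symm.eq) g
  exact Subgroup.mem_centralizer_singleton_iff.1 this

theorem P5.fiberRel : FiberRel (P5.x .x12) (P5.x .x23) (P5.x5 0) (P5.x5 1) (P5.x5 2) :=
  P5.pureBraid.fiberRel P5.fullTwist_eq_one

theorem P5.x_eq_fiberVal :
    P5.x = fiberVal (P5.x .x12) (P5.x .x23) (P5.x5 0) (P5.x5 1) (P5.x5 2) :=
  P5.pureBraid.eq_fiberVal P5.fullTwist_eq_one

theorem P5.closure_range_x : Subgroup.closure (Set.range P5.x) = ⊤ := by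
  have : Set.range P5.x = QuotientGroup.mk' (Subgroup.center K4) ''
      Set.range (PresentedGroup.of : Gen → K4) := by
    rw [← Set.range_comp]; rfl
  rw [this, ← MonoidHom.map_closure, PresentedGroup.closure_range_of,
    Subgroup.map_top_of_surjective _ (QuotientGroup.mk'_surjective _)]

theorem P5.closure_fiber :
    Subgroup.closure {P5.x .x12, P5.x .x23, P5.x5 0, P5.x5 1, P5.x5 2} = ⊤ := by
  rw [eq_top_iff, ← P5.closure_range_x, Subgroup.closure_le]
  set L := Subgroup.closure {P5.x .x12, P5.x .x23, P5.x5 0, P5.x5 1, P5.x5 2}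
  have ha : P5.x .x12 ∈ L := Subgroup.subset_closure (by simp)
  have hd : P5.x .x23 ∈ L := Subgroup.subset_closure (by simp)
  have hx : P5.x5 0 ∈ L := Subgroup.subset_closure (by simp)
  have hy : P5.x5 1 ∈ L := Subgroup.subset_closure (by simp)
  have hz : P5.x5 2 ∈ L := Subgroup.subset_closure (by simp)
  rintro _ ⟨s, rfl⟩
  rw [P5.x_eq_fiberVal]
  cases s <;> simp only [fiberVal] <;>
    repeat' first | assumption | apply L.mul_mem | apply L.inv_mem

theorem range_x5 : Set.range P5.x5 = {P5.x5 0, P5.x5 1, P5.x5 2} := by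
  ext g
  simp [Fin.exists_fin_succ, eq_comm]

theorem P5.normal_closure_x5 : (Subgroup.closure (Set.range P5.x5)).Normal := by
  rw [range_x5]
  exact P5.fiberRel.normal P5.closure_fiber

/-- Every `g` differs from `ℓ(pr₅ g)` by an element of the group generated by the `x_{i5}`, as this
holds for the generators `x₁₂`, `x₂₃` and `x_{i5}` of `P₅*`. -/
theorem P5.mul_inv_ell_pr5_mem (g : P5) :
    g * (ell (pr5 g))⁻¹ ∈ Subgroup.closure (Set.range P5.x5) := by
  have := P5.normal_closure_x5
  set N := Subgroup.closure (Set.range P5.x5)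
  have hx5 : ∀ i, QuotientGroup.mk' N (P5.x5 i) = 1 := fun i =>
    (QuotientGroup.eq_one_iff _).2 (Subgroup.subset_closure ⟨i, rfl⟩)
  -- modulo `N`, both sides agree on generators
  have h : QuotientGroup.mk' N = (QuotientGroup.mk' N).comp (ell.comp pr5) := by
    refine MonoidHom.eq_of_eqOn_dense P5.closure_fiber ?_
    rintro g (rfl | rfl | rfl | rfl | rfl)
    · simp [pr5, P5.lift_x, pr5Val, ell]
    · simp [pr5, P5.lift_x, pr5Val, ell]
    all_goals
      rw [hx5, MonoidHom.comp_apply, MonoidHom.comp_apply, pr5_x5, map_one, map_one]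
  rw [← QuotientGroup.eq_one_iff (N := N)]
  have := DFunLike.congr_fun h g
  simp only [MonoidHom.comp_apply, QuotientGroup.mk'_apply] at this
  rw [QuotientGroup.mk_mul, QuotientGroup.mk_inv, ← this, mul_inv_cancel]

/-! ### The matrices `rρ(X₀)` and `rρ(X₁)` -/

section Triangular

variable (k : Type*) [CommRing k]

/-- The elements `g ⊗ h` of `V ⊗ V`, for `g` and `h` in `F₂`. -/
def wt : F2 × F2 →* VV k where
  toFun p := MonoidAlgebra.of k F2 p.1 ⊗ₜ[k] MonoidAlgebra.of k F2 p.2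
  map_one' := by rw [Prod.fst_one, Prod.snd_one, map_one, Algebra.TensorProduct.one_def]
  map_mul' p q := by
    rw [Algebra.TensorProduct.tmul_mul_tmul, Prod.fst_mul, Prod.snd_mul, map_mul, map_mul]

theorem wt_X (i : Fin 2) : wt k (FreeGroup.of i, 1) = XU k i := by
  simp [wt, XU, MonoidAlgebra.one_def]

theorem wt_Y (i : Fin 2) : wt k (1, FreeGroup.of i) = YU k i := by
  simp [wt, YU, MonoidAlgebra.one_def]

theorem wt_X_inv (i : Fin 2) : wt k ((FreeGroup.of i)⁻¹, 1) = ↑(XU k i)⁻¹ := by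
  refine (Units.inv_eq_of_mul_eq_one_right ?_).symm
  rw [← wt_X, ← map_mul, Prod.mk_mul_mk, mul_inv_cancel, one_mul, ← Prod.one_eq_mk, map_one]

theorem wt_Y_inv (i : Fin 2) : wt k (1, (FreeGroup.of i)⁻¹) = ↑(YU k i)⁻¹ := by
  refine (Units.inv_eq_of_mul_eq_one_right ?_).symm
  rw [← wt_Y, ← map_mul, Prod.mk_mul_mk, mul_inv_cancel, one_mul, ← Prod.one_eq_mk, map_one]

theorem opVV_wt (g h : F2) : opVV k (op (wt k (g, h))) = wt k (g⁻¹, h⁻¹) := by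
  simp [wt, opVV, opG]

theorem opVV_X (i : Fin 2) : opVV k (op ↑(XU k i)) = ↑(XU k i)⁻¹ := by
  rw [← wt_X, opVV_wt, inv_one, wt_X_inv]

theorem opVV_Y (i : Fin 2) : opVV k (op ↑(YU k i)) = ↑(YU k i)⁻¹ := by
  rw [← wt_Y, opVV_wt, inv_one, wt_Y_inv]

theorem opVV_X_inv (i : Fin 2) : opVV k (op ↑(XU k i)⁻¹) = ↑(XU k i) := by
  rw [← wt_X_inv, opVV_wt, inv_one, inv_inv, wt_X]

theorem opVV_Y_inv (i : Fin 2) : opVV k (op ↑(YU k i)⁻¹) = ↑(YU k i) := by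
  rw [← wt_Y_inv, opVV_wt, inv_one, inv_inv, wt_Y]

theorem rRho_apply (g : F2) (i j : Fin 3) :
    rRho k (MonoidAlgebra.of k F2 g) i j =
      ↑(diagU k i)⁻¹ * opVV k (op (rhoUnd k (MonoidAlgebra.of k F2 g⁻¹) j i)) * diagU k j := by
  simp [rRho, adDiagInv, opG]

theorem rRho_X0 : rRho k (MonoidAlgebra.of k F2 X0) =
    !![(XU k 0 : VV k), 0, 0;
      0, ↑(XU k 1)⁻¹ * (↑(YU k 1)⁻¹ * YU k 0 * YU k 1),
        ↑(XU k 1)⁻¹ * (↑(YU k 1)⁻¹ * YU k 0 * YU k 1) -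
          ↑(XU k 1)⁻¹ * ↑(XU k 1)⁻¹ * ↑(XU k 0)⁻¹ * (↑(YU k 1)⁻¹ * YU k 0 * YU k 0 * YU k 1);
      0, XU k 0 - XU k 0 * XU k 1,
        (1 - XU k 0 * ↑(XU k 1)⁻¹ * ↑(XU k 0)⁻¹) * (↑(YU k 1)⁻¹ * YU k 0 * YU k 1) + XU k 0] := by
  ext i j
  rw [rRho_apply]
  fin_cases i <;> fin_cases j <;>
    simp [rhoUnd, rhoMat0Inv, diagU, opVV_X, opVV_Y, opVV_X_inv, opVV_Y_inv,
      mul_add, add_mul, mul_sub, sub_mul, mul_assoc,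
      comm_simps (commute_X_Y k _ _)]

theorem rRho_X1 : rRho k (MonoidAlgebra.of k F2 X1) =
    !![(XU k 1 : VV k), (1 - XU k 1) * XU k 1, 0;
      1 - YU k 1, 1 - XU k 1 + XU k 1 * YU k 1, 0;
      0, 0, 1] := by
  ext i j
  rw [rRho_apply]
  fin_cases i <;> fin_cases j <;>
    simp [rhoUnd, rhoMat1Inv, diagU, opVV_Y, opVV_X_inv, opVV_Y_inv,
      mul_add, add_mul, mul_sub, sub_mul, mul_assoc,
      comm_simps (commute_X_Y k _ _)]

end Triangular

/-! ### Block triangular matrices -/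

section Triangular

open scoped Matrix

/-- The group of block triangular matrices `(ρ(v) u; 0 e(w))`, with an upper left block of size
three, a column `u` and a lower right entry.  The diagonal blocks are recorded by group elements
`v` and `w` rather than by `ρ v` and `e w`. -/
@[ext] structure TriMat {A H Q : Type*} [Ring A] [Group H] [Group Q]
    (ρ : H →* Matrix (Fin 3) (Fin 3) A) (e : Q →* A) where
  /-- The group element giving the upper left block. -/
  v : H
  /-- The upper right block. -/
  u : Fin 3 → A
  /-- The group element giving the lower right entry. -/
  w : Q

namespace TriMat

variable {A H Q : Type*} [Ring A] [Group H] [Group Q]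
    {ρ : H →* Matrix (Fin 3) (Fin 3) A} {e : Q →* A}

instance : Mul (TriMat ρ e) :=
  ⟨fun s t => ⟨s.v * t.v, ρ s.v *ᵥ t.u + op (e t.w) • s.u, s.w * t.w⟩⟩

instance : One (TriMat ρ e) := ⟨⟨1, 0, 1⟩⟩

instance : Inv (TriMat ρ e) := ⟨fun s => ⟨s.v⁻¹, -(ρ s.v⁻¹ *ᵥ (op (e s.w⁻¹) • s.u)), s.w⁻¹⟩⟩

@[simp] theorem mul_v (s t : TriMat ρ e) : (s * t).v = s.v * t.v := rfl
theorem mul_u (s t : TriMat ρ e) : (s * t).u = ρ s.v *ᵥ t.u + op (e t.w) • s.u := rfl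
@[simp] theorem mul_w (s t : TriMat ρ e) : (s * t).w = s.w * t.w := rfl
@[simp] theorem inv_v (s : TriMat ρ e) : s⁻¹.v = s.v⁻¹ := rfl
theorem inv_u (s : TriMat ρ e) : s⁻¹.u = -(ρ s.v⁻¹ *ᵥ (op (e s.w⁻¹) • s.u)) := rfl
@[simp] theorem inv_w (s : TriMat ρ e) : s⁻¹.w = s.w⁻¹ := rfl
@[simp] theorem one_v : (1 : TriMat ρ e).v = 1 := rfl
@[simp] theorem one_u : (1 : TriMat ρ e).u = 0 := rfl
@[simp] theorem one_w : (1 : TriMat ρ e).w = 1 := rfl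

instance : Group (TriMat ρ e) :=
  Group.ofLeftAxioms
    (fun r s t => by
      ext1
      · exact mul_assoc _ _ _
      · simp only [mul_u, mul_v, mul_w, map_mul, op_mul, Matrix.mulVec_add, Matrix.mulVec_smul,
          Matrix.mulVec_mulVec, smul_add, mul_smul, add_assoc]
      · exact mul_assoc _ _ _)
    (fun s => by
      ext1
      · exact one_mul _
      · simp [mul_u]
      · exact one_mul _)
    (fun s => by
      ext1
      · exact inv_mul_cancel _
      · rw [mul_u, inv_u, inv_v, one_u, smul_neg, ← Matrix.mulVec_smul, smul_smul, ← op_mul,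
          ← map_mul, inv_mul_cancel, map_one, op_one, one_smul, add_neg_cancel]
      · exact inv_mul_cancel _)

theorem mul_u_apply (s t : TriMat ρ e) (i : Fin 3) :
    (s * t).u i = ∑ j, ρ s.v i j * t.u j + s.u i * e t.w := rfl

variable (ρ e) in
/-- The projection to the group element `v` of the upper left block. -/
def vHom : TriMat ρ e →* H := ⟨⟨v, rfl⟩, fun _ _ => rfl⟩

variable (ρ e) in
/-- The projection to the group element `w` of the lower right entry. -/
def wHom : TriMat ρ e →* Q := ⟨⟨w, rfl⟩, fun _ _ => rfl⟩

variable (ρ e) in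
/-- The subgroup of block diagonal matrices. -/
def blockDiag : Subgroup (TriMat ρ e) where
  carrier := {s | s.u = 0}
  mul_mem' {s t} hs ht := by
    change (s * t).u = 0
    rw [mul_u, show s.u = 0 from hs, show t.u = 0 from ht, Matrix.mulVec_zero, smul_zero, add_zero]
  one_mem' := rfl
  inv_mem' {s} hs := by
    change s⁻¹.u = 0
    rw [inv_u, show s.u = 0 from hs, smul_zero, Matrix.mulVec_zero, neg_zero]

/-- The matrix with trivial upper left block and column `e_i`; the image of `x_{i5}` is of this form. -/
abbrev unip (i : Fin 3) (q : Q) : TriMat ρ e := ⟨1, Pi.single i 1, q⟩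

/-- The relations satisfied by the images of `x₁₂`, `x₂₃` (block diagonal) and of the `x_{i5}`.
Comparing the columns `u` of both sides, the relations for `g0` and `g1` determine the columns of
`ρ g0` and `ρ g1`, and these are the columns of `rρ(X₀)` and `rρ(X₁)`. -/
theorem fiberRel {x0 x1 y0 y1 : Aˣ} (hc : CommUnits x0 x1 y0 y1) {g0 g1 : H} {a d x y z : Q}
    (hQ : FiberRel a d x y z)
    (h0 : ρ g0 = !![(x0 : A), 0, 0;
      0, ↑x1⁻¹ * (↑y1⁻¹ * y0 * y1),
        ↑x1⁻¹ * (↑y1⁻¹ * y0 * y1) - ↑x1⁻¹ * ↑x1⁻¹ * ↑x0⁻¹ * (↑y1⁻¹ * y0 * y0 * y1);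
      0, x0 - x0 * x1, (1 - x0 * ↑x1⁻¹ * ↑x0⁻¹) * (↑y1⁻¹ * y0 * y1) + x0])
    (h1 : ρ g1 = !![(x1 : A), (1 - x1) * x1, 0; 1 - y1, 1 - x1 + x1 * y1, 0; 0, 0, 1])
    (ha : e a = 1) (hd : e d = x0) (hx : e x = y1) (hy : e y = x1)
    (hz : e z = ↑x1⁻¹ * ↑x0⁻¹ * (↑y1⁻¹ * y0 * y1)) :
    FiberRel (⟨g1, 0, a⟩ : TriMat ρ e) ⟨g0, 0, d⟩ (unip 0 x) (unip 1 y) (unip 2 z) := by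
  obtain ⟨h00, h01, h10, h11⟩ := hc
  obtain ⟨r1, r2, r3, r4, r5, r6⟩ := hQ
  constructor <;> refine TriMat.ext ?_ (funext fun i => ?_) ?_
  · simp
  · fin_cases i <;> simp [mul_u_apply, Fin.sum_univ_three, ha, h1]
  · exact r1
  · simp
  · fin_cases i <;> simp [mul_u_apply, Fin.sum_univ_three, hd, h0]
  · exact r2
  · simp
  · fin_cases i <;> simp [mul_u_apply, Fin.sum_univ_three, ha, hx, hy, h1, sub_mul, mul_assoc,
      comm_simps h11]
  · exact r3
  · simp
  · fin_cases i <;> simp [mul_u_apply, Fin.sum_univ_three, ha, hx, hy, h1, sub_mul, mul_assoc,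
      comm_simps h11]
    abel
  · exact r4
  · simp
  · fin_cases i <;> simp [mul_u_apply, Fin.sum_univ_three, hd, hy, hz, h0, sub_mul, mul_assoc,
      comm_simps h00, comm_simps h01, comm_simps h10, comm_simps h11]
  · exact r5
  · simp
  · fin_cases i <;> simp [mul_u_apply, Fin.sum_univ_three, hd, hy, hz, h0, sub_mul, mul_assoc,
      comm_simps h00, comm_simps h01, comm_simps h10, comm_simps h11]
    abel
  · exact r6

end TriMat


variable (k : Type*) [CommRing k]

/-- The restriction of `rρ` to `F₂`. -/
def rRhoGrp : F2 →* Matrix (Fin 3) (Fin 3) (VV k) :=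
  (rRho k : VB k →* _).comp (MonoidAlgebra.of k F2)

/-- The images of `x₁₅`, `x₂₅`, `x₃₅` under `(pr₁, pr₂)`. -/
def x5Pr : Fin 3 → F2 × F2 := ![(1, X1), (X1, 1), ((X0 * X1)⁻¹, X1⁻¹ * X0 * X1)]

theorem x5Pr_fiberRel : FiberRel 1 (X0, 1) (x5Pr 0) (x5Pr 1) (x5Pr 2) := by
  constructor <;> simp [x5Pr, Commute, SemiconjBy, mul_assoc]

theorem triMat_fiberRel : FiberRel (⟨X1, 0, 1⟩ : TriMat (rRhoGrp k) (wt k)) ⟨X0, 0, (X0, 1)⟩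
    (TriMat.unip 0 (x5Pr 0)) (TriMat.unip 1 (x5Pr 1)) (TriMat.unip 2 (x5Pr 2)) := by
  refine TriMat.fiberRel (commUnits_X_Y k) x5Pr_fiberRel (rRho_X0 k) (rRho_X1 k) (map_one _)
    (wt_X k 0) (wt_Y k 1) (wt_X k 1) ?_
  rw [← wt_X_inv, ← wt_X_inv, ← wt_Y_inv, ← wt_Y, ← wt_Y]
  simp only [← map_mul, Prod.mk_mul_mk, mul_inv_rev, mul_one, one_mul, x5Pr, Matrix.cons_val]

end Triangular

/-! ### The Fox derivative on `P₅*` -/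

section Fox

open scoped Matrix

theorem fiberVal_x5 {H : Type*} [Group H] (a d x y z : H) :
    ((fiberVal a d x y z .x12 * fiberVal a d x y z .x13 * fiberVal a d x y z .x14)⁻¹ = x) ∧
    ((fiberVal a d x y z .x12 * fiberVal a d x y z .x23 * fiberVal a d x y z .x24)⁻¹ = y) ∧
    ((fiberVal a d x y z .x13 * fiberVal a d x y z .x23 * fiberVal a d x y z .x34)⁻¹ = z) := by
  simp only [fiberVal]
  refine ⟨?_, ?_, ?_⟩ <;> group

variable (k : Type*) [CommRing k]

theorem mul_of_X1_sub_one_injective :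
    Function.Injective (LinearMap.mulRight k (MonoidAlgebra.of k F2 X1 - 1)) := by
  rw [injective_iff_map_eq_zero]
  intro t ht
  rw [LinearMap.mulRight_apply, mul_sub, mul_one, sub_eq_zero] at ht
  have step (g : F2) : t.coeff (g * X1) = t.coeff g := by
    conv_lhs => rw [← ht]
    rw [MonoidAlgebra.of_apply, MonoidAlgebra.coeff_mul_single_mul, mul_one]
  -- a nonzero coefficient at `g` would recur at the infinitely many elements `g X₁ⁿ`
  ext g
  by_contra hg
  have pow (n : ℕ) : t.coeff (g * X1 ^ n) = t.coeff g := by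
    induction n with
    | zero => simp
    | succ n ih => rw [pow_succ, ← mul_assoc, step, ih]
  have hinj : Function.Injective fun n : ℕ => g * X1 ^ n :=
    (mul_right_injective g).comp (injective_pow_iff_not_isOfFinOrder.2 (by
      rw [isOfFinOrder_iff_eq_one]
      exact FreeGroup.of_ne_one _))
  refine Set.infinite_of_injective_forall_mem (s := (t.coeff.support : Set F2)) hinj
    (fun n => ?_) (Finset.finite_toSet _)
  simpa [pow n] using hg

/-- Right multiplication by `Y₁ - 1` is injective on `V ⊗ V`, by flatness of `V`. -/
theorem eq_zero_of_mul_Y1_eq (t : VV k) (ht : t * YU k 1 = t) : t = 0 := by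
  have : Module.Free k (VB k) := Module.Free.of_basis (MonoidAlgebra.basis F2 k)
  have hinj := Module.Flat.lTensor_preserves_injective_linearMap (M := VB k) _
    (mul_of_X1_sub_one_injective k)
  refine (injective_iff_map_eq_zero _).1 hinj t ?_
  have : LinearMap.lTensor (VB k) (LinearMap.mulRight k (MonoidAlgebra.of k F2 X1 - 1)) =
      LinearMap.mulRight k (YU k 1 - 1 : VV k) := by
    refine TensorProduct.ext' fun a b => ?_
    simp [YU, mul_sub, TensorProduct.tmul_sub]
  rw [this, LinearMap.mulRight_apply, mul_sub, ht, mul_one, sub_self]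

/-- The morphism from `K₄` to block triangular matrices, determined by the images of `x₁₂`, `x₂₃` and
`x_{i5}`. -/
def triK4 : K4 →* TriMat (rRhoGrp k) (wt k) :=
  PresentedGroup.toGroup ((lift_K4Rels_iff _).2 (triMat_fiberRel k).pureBraid)

theorem triK4_of (s : Gen) : triK4 k (.of s) = fiberVal (⟨X1, 0, 1⟩ : TriMat (rRhoGrp k) (wt k))
    ⟨X0, 0, (X0, 1)⟩ (.unip 0 (x5Pr 0)) (.unip 1 (x5Pr 1)) (.unip 2 (x5Pr 2)) s :=
  PresentedGroup.toGroup.of _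

theorem triK4_v (g : K4) : (triK4 k g).v = pr5 (QuotientGroup.mk g) := by
  have : (TriMat.vHom _ _).comp (triK4 k) = pr5.comp (QuotientGroup.mk' (Subgroup.center K4)) :=
    PresentedGroup.ext fun s => by
      have h : pr5 (QuotientGroup.mk' (Subgroup.center K4) (.of s)) = pr5Val s := P5.lift_x _ _ _ s
      rw [MonoidHom.comp_apply, MonoidHom.comp_apply, h, triK4_of]
      cases s <;> simp [TriMat.vHom, fiberVal, pr5Val]
  exact DFunLike.congr_fun this g

theorem triK4_w (g : K4) :
    (triK4 k g).w = (pr1 (QuotientGroup.mk g), pr2 (QuotientGroup.mk g)) := by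
  have : (TriMat.wHom _ _).comp (triK4 k) =
      (pr1.prod pr2).comp (QuotientGroup.mk' (Subgroup.center K4)) :=
    PresentedGroup.ext fun s => by
      have h1 : pr1 (QuotientGroup.mk' (Subgroup.center K4) (.of s)) = pr1Val s := P5.lift_x _ _ _ s
      have h2 : pr2 (QuotientGroup.mk' (Subgroup.center K4) (.of s)) = pr2Val s := P5.lift_x _ _ _ s
      rw [MonoidHom.comp_apply, MonoidHom.comp_apply, MonoidHom.prod_apply, h1, h2, triK4_of]
      cases s <;> simp [TriMat.wHom, fiberVal, pr1Val, pr2Val, x5Pr, mul_assoc, Prod.one_eq_mk]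
  exact DFunLike.congr_fun this g

/-- A central element has trivial diagonal blocks, and a column `u` with `u Y₁ = u`, as its image
commutes with that of `x₁₅`. -/
theorem center_le_ker_triK4 : Subgroup.center K4 ≤ (triK4 k).ker := by
  intro z hz
  have hz1 : (QuotientGroup.mk z : P5) = 1 := (QuotientGroup.eq_one_iff z).2 hz
  have hv : (triK4 k z).v = 1 := by rw [triK4_v, hz1, map_one]
  have hw : (triK4 k z).w = 1 := by rw [triK4_w, hz1, map_one, map_one]; rfl
  have hx : triK4 k (.of .x12 * .of .x13 * .of .x14)⁻¹ = .unip 0 (x5Pr 0) := by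
    simp only [map_inv, map_mul, triK4_of]
    exact (fiberVal_x5 _ _ _ _ _).1
  have hc : triK4 k z * .unip 0 (x5Pr 0) = .unip 0 (x5Pr 0) * triK4 k z := by
    rw [← hx, ← map_mul, ← map_mul, Subgroup.mem_center_iff.1 hz]
  refine MonoidHom.mem_ker.2 (TriMat.ext hv (funext fun i => eq_zero_of_mul_Y1_eq k _ ?_) hw)
  have := congrFun (congrArg TriMat.u hc) i
  rw [TriMat.mul_u, TriMat.mul_u, hv, hw, map_one, map_one, Matrix.one_mulVec,
    Matrix.one_mulVec, op_one, one_smul, add_comm, Pi.add_apply, Pi.add_apply,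
    add_left_inj] at this
  rw [← wt_Y]
  exact this

/-- The morphism from `P₅*` to block triangular matrices induced by `triK4`. -/
def triP5 : P5 →* TriMat (rRhoGrp k) (wt k) :=
  QuotientGroup.lift (Subgroup.center K4) (triK4 k) (center_le_ker_triK4 k)

theorem triP5_v (g : P5) : (triP5 k g).v = pr5 g := by
  obtain ⟨g, rfl⟩ := QuotientGroup.mk_surjective g
  exact triK4_v k g

theorem triP5_w (g : P5) : (triP5 k g).w = (pr1 g, pr2 g) := by
  obtain ⟨g, rfl⟩ := QuotientGroup.mk_surjective g
  exact triK4_w k g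

theorem triP5_x (s : Gen) : triP5 k (P5.x s) = fiberVal (⟨X1, 0, 1⟩ : TriMat (rRhoGrp k) (wt k))
    ⟨X0, 0, (X0, 1)⟩ (.unip 0 (x5Pr 0)) (.unip 1 (x5Pr 1)) (.unip 2 (x5Pr 2)) s :=
  triK4_of k s

theorem triP5_x5 (i : Fin 3) : triP5 k (P5.x5 i) = .unip i (x5Pr i) := by
  have h := fiberVal_x5 (⟨X1, 0, 1⟩ : TriMat (rRhoGrp k) (wt k))
    ⟨X0, 0, (X0, 1)⟩ (.unip 0 (x5Pr 0)) (.unip 1 (x5Pr 1)) (.unip 2 (x5Pr 2))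
  fin_cases i <;> simp only [P5.x5, Fin.zero_eta, Fin.mk_one, Fin.reduceFinMk, Matrix.cons_val,
    map_inv, map_mul, triP5_x]
  exacts [h.1, h.2.1, h.2.2]

/-- The Fox derivative `D : k P₅* → (V ⊗ V)³`: the linear extension of the column `u` of `triP5`. -/
def foxD : MonoidAlgebra k P5 →ₗ[k] (Fin 3 → VV k) :=
  (MonoidAlgebra.basis P5 k).constr k fun g => (triP5 k g).u

theorem foxD_of (g : P5) : foxD k (.of k P5 g) = (triP5 k g).u := by
  have : MonoidAlgebra.of k P5 g = MonoidAlgebra.basis P5 k g := by simp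
  rw [this, foxD, Module.Basis.constr_basis]

theorem kpr12_of (g : P5) : kpr12 k (.of k P5 g) = wt k (pr1 g, pr2 g) :=
  MonoidAlgebra.lift_of _ _

/-- The Leibniz rule, which is the rule for multiplying block triangular matrices. -/
theorem foxD_mul (x y : MonoidAlgebra k P5) :
    foxD k (x * y) = rRho k (kpr5 k x) *ᵥ foxD k y + fun i => foxD k x i * kpr12 k y := by
  induction x using MonoidAlgebra.induction_on with
  | of g =>
    induction y using MonoidAlgebra.induction_on with
    | of h =>
      rw [← map_mul, foxD_of, foxD_of, foxD_of, map_mul, TriMat.mul_u, triP5_v, triP5_w,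
        groupAlgMap_of, kpr12_of]
      rfl
    | add y z hy hz =>
      ext i
      simp only [mul_add, map_add, hy, hz, Matrix.mulVec_add, Pi.add_apply]
      abel
    | smul r y hy =>
      ext i
      simp only [mul_smul_comm, map_smul, hy, Matrix.mulVec_smul, Pi.add_apply, Pi.smul_apply,
        smul_add]
  | add x z hx hz =>
    ext i
    simp only [add_mul, map_add, hx, hz, Matrix.add_mulVec, Pi.add_apply]
    abel
  | smul r x hx =>
    ext i
    simp only [smul_mul_assoc, map_smul, hx, Matrix.smul_mulVec, Pi.add_apply, Pi.smul_apply,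
        smul_add]

theorem foxD_one : foxD k 1 = 0 := by
  rw [← map_one (MonoidAlgebra.of k P5), foxD_of, map_one, TriMat.one_u]

theorem foxD_x5 (i : Fin 3) : foxD k (.of k P5 (P5.x5 i) - 1) = Pi.single i 1 := by
  rw [map_sub, foxD_one, foxD_of, triP5_x5, sub_zero]

theorem foxD_kell (v : VB k) : foxD k (kell k v) = 0 := by
  induction v using MonoidAlgebra.induction_on with
  | of g =>
    have h : (TriMat.blockDiag (rRhoGrp k) (wt k)).comap ((triP5 k).comp ell) = ⊤ := by
      rw [eq_top_iff, ← FreeGroup.closure_range_of, Subgroup.closure_le]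
      rintro _ ⟨i, rfl⟩
      change (triP5 k (ell (FreeGroup.of i))).u = 0
      rw [ell, FreeGroup.lift_apply_of]
      fin_cases i
      · exact congrArg TriMat.u (triP5_x k .x23)
      · exact congrArg TriMat.u (triP5_x k .x12)
    rw [groupAlgMap_of, foxD_of]
    exact h.ge (Subgroup.mem_top g)
  | add x y hx hy => rw [map_add, map_add, hx, hy, add_zero]
  | smul r x hx => rw [map_smul, map_smul, hx, smul_zero]

end Fox

/-! ### The isomorphism -/

section Iso

open scoped Matrix

variable (k : Type*) [CommRing k]

/-- The right ideal of `k P₅*` generated by the `x_{i5} - 1`. -/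
def x5Ideal : Submodule k (MonoidAlgebra k P5) :=
  LinearMap.range (∑ i : Fin 3, (LinearMap.mulLeft k (MonoidAlgebra.of k P5 (P5.x5 i) - 1)).comp
    (LinearMap.proj i : (Fin 3 → MonoidAlgebra k P5) →ₗ[k] _))

theorem mem_x5Ideal {x : MonoidAlgebra k P5} : x ∈ x5Ideal k ↔
    ∃ b : Fin 3 → MonoidAlgebra k P5, ∑ i, (MonoidAlgebra.of k P5 (P5.x5 i) - 1) * b i = x := by
  simp [x5Ideal, LinearMap.mem_range]

theorem mul_mem_x5Ideal {x : MonoidAlgebra k P5} (hx : x ∈ x5Ideal k) (y : MonoidAlgebra k P5) :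
    x * y ∈ x5Ideal k := by
  obtain ⟨b, rfl⟩ := (mem_x5Ideal k).1 hx
  exact (mem_x5Ideal k).2 ⟨fun i => b i * y, by simp only [Finset.sum_mul, mul_assoc]⟩

theorem of_sub_one_mem_x5Ideal {n : P5} (hn : n ∈ Subgroup.closure (Set.range P5.x5)) :
    MonoidAlgebra.of k P5 n - 1 ∈ x5Ideal k := by
  induction hn using Subgroup.closure_induction with
  | mem x hx =>
    obtain ⟨i, rfl⟩ := hx
    exact (mem_x5Ideal k).2 ⟨Pi.single i 1, by simp [Pi.single_apply]⟩
  | one => rw [map_one, sub_self]; exact zero_mem _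
  | mul x y _ _ hx hy =>
    have : MonoidAlgebra.of k P5 (x * y) - 1 =
        (MonoidAlgebra.of k P5 x - 1) * MonoidAlgebra.of k P5 y + (MonoidAlgebra.of k P5 y - 1) := by
      rw [map_mul]; noncomm_ring
    rw [this]
    exact add_mem (mul_mem_x5Ideal k hx _) hy
  | inv x _ hx =>
    have : MonoidAlgebra.of k P5 x⁻¹ - 1 =
        -((MonoidAlgebra.of k P5 x - 1) * MonoidAlgebra.of k P5 x⁻¹) := by
      rw [sub_mul, ← map_mul, mul_inv_cancel, map_one, one_mul, neg_sub]
    rw [this]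
    exact neg_mem (mul_mem_x5Ideal k hx _)

/-- In particular, the kernel of `k pr₅` is contained in the right ideal generated by the
`x_{i5} - 1`. -/
theorem sub_kell_kpr5_mem_x5Ideal (x : MonoidAlgebra k P5) :
    x - kell k (kpr5 k x) ∈ x5Ideal k := by
  induction x using MonoidAlgebra.induction_on with
  | of g =>
    have : MonoidAlgebra.of k P5 g - kell k (kpr5 k (.of k P5 g)) =
        (MonoidAlgebra.of k P5 (g * (ell (pr5 g))⁻¹) - 1) * MonoidAlgebra.of k P5 (ell (pr5 g)) := by
      rw [sub_mul, ← map_mul, inv_mul_cancel_right, one_mul, groupAlgMap_of, groupAlgMap_of]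
    rw [this]
    exact mul_mem_x5Ideal k (of_sub_one_mem_x5Ideal k (P5.mul_inv_ell_pr5_mem g)) _
  | add x y hx hy =>
    rw [map_add, map_add, add_sub_add_comm]
    exact add_mem hx hy
  | smul r x hx =>
    rw [map_smul, map_smul, ← smul_sub]
    exact Submodule.smul_mem _ r hx

theorem kpr5_kell (v : VB k) : kpr5 k (kell k v) = v := by
  have hg : pr5.comp ell = MonoidHom.id F2 := by
    refine FreeGroup.ext_hom _ _ fun i => ?_
    rw [MonoidHom.comp_apply, ell, FreeGroup.lift_apply_of]
    fin_cases i <;> exact P5.lift_x _ _ _ _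
  induction v using MonoidAlgebra.induction_on with
  | of g => rw [groupAlgMap_of, groupAlgMap_of]; exact congrArg _ (DFunLike.congr_fun hg g)
  | add x y hx hy => rw [map_add, map_add, hx, hy]
  | smul r x hx => rw [map_smul, map_smul, hx]

/-- The map `Φ : (a₁, a₂, a₃) ↦ ∑ (x_{i5} - 1) ⊗ a_i`. -/
def bimodHom : (Fin 3 → VV k) →ₗ[(VV k)ᵐᵒᵖ] MB k where
  toFun a := ∑ i : Fin 3, KerTensor.tmul (kpr5 k) (kpr12 k) (x5SubOne k i) (a i)
  map_add' a b := by
    rw [← Finset.sum_add_distrib]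
    refine Finset.sum_congr rfl fun i _ => ?_
    rw [KerTensor.tmul, Pi.add_apply, TensorProduct.tmul_add, map_add]
    rfl
  map_smul' c a := by
    rw [RingHom.id_apply, Finset.smul_sum]
    rfl

/-- The inverse `n ⊗ a ↦ D(n) a` of `Φ`.  It is well defined as `D(n b) = D(n) pr₁₂(b)` for `n` in the
kernel of `k pr₅`. -/
def bimodInv : MB k →ₗ[k] (Fin 3 → VV k) :=
  (balancedRel (kpr5 k) (kpr12 k)).liftQ
    (TensorProduct.lift (LinearMap.mk₂ k
      (fun (n : KerMod (kpr5 k)) (a : VV k) (i : Fin 3) => foxD k (KerMod.incl _ n) i * a)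
      (fun m n a => funext fun i => by rw [map_add, map_add, Pi.add_apply, add_mul]; rfl)
      (fun r n a => funext fun i => by rw [map_smul, map_smul, Pi.smul_apply, smul_mul_assoc]; rfl)
      (fun n a b => funext fun i => by rw [mul_add]; rfl)
      (fun r n a => funext fun i => by rw [mul_smul_comm]; rfl))) <| by
    refine Submodule.span_le.2 ?_
    rintro _ ⟨n, b, a, rfl⟩
    rw [SetLike.mem_coe, LinearMap.mem_ker, map_sub, sub_eq_zero, TensorProduct.lift.tmul,
      TensorProduct.lift.tmul, LinearMap.mk₂_apply, LinearMap.mk₂_apply]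
    funext i
    have : KerMod.incl (kpr5 k) (kerMulRight (kpr5 k) b n) = KerMod.incl _ n * b := rfl
    rw [this, foxD_mul, KerMod.map_incl, map_zero, Matrix.zero_mulVec, zero_add, mul_assoc]

theorem bimodInv_tmul (n : KerMod (kpr5 k)) (a : VV k) (i : Fin 3) :
    bimodInv k (KerTensor.tmul _ _ n a) i = foxD k (KerMod.incl _ n) i * a := rfl

theorem bimodInv_bimodHom (a : Fin 3 → VV k) : bimodInv k (bimodHom k a) = a := by
  funext i
  have : bimodHom k a = ∑ i : Fin 3, KerTensor.tmul (kpr5 k) (kpr12 k) (x5SubOne k i) (a i) := rfl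
  rw [this, map_sum, Finset.sum_apply]
  simp only [bimodInv_tmul]
  have h (j : Fin 3) : foxD k (KerMod.incl _ (x5SubOne k j)) = Pi.single j 1 := foxD_x5 k j
  simp [h, Pi.single_apply]

theorem tmulOne_mem_range (n : KerMod (kpr5 k)) :
    KerTensor.tmulOne (kpr5 k) (kpr12 k) n ∈ LinearMap.range (bimodHom k) := by
  have hn := sub_kell_kpr5_mem_x5Ideal k (KerMod.incl _ n)
  rw [KerMod.map_incl, map_zero, sub_zero] at hn
  obtain ⟨b, hb⟩ := (mem_x5Ideal k).1 hn
  have hsum : n = ∑ i, kerMulRight (kpr5 k) (b i) (x5SubOne k i) := by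
    refine KerMod.ext ?_
    rw [map_sum (KerMod.incl (kpr5 k)), ← hb]
    rfl
  refine ⟨fun i => kpr12 k (b i), ?_⟩
  change ∑ i, KerTensor.tmul _ _ (x5SubOne k i) (kpr12 k (b i)) = _
  rw [hsum, map_sum]
  refine Finset.sum_congr rfl fun i _ => ?_
  rw [KerTensor.tmulOne_apply, KerTensor.tmul_balanced, mul_one]

theorem bimodHom_surjective : Function.Surjective (bimodHom k) := by
  intro m
  obtain ⟨t, rfl⟩ := KerTensor.mk_surjective _ _ m
  rw [← LinearMap.mem_range]
  induction t using TensorProduct.induction_on with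
  | zero => rw [map_zero]; exact zero_mem _
  | tmul n a =>
    have : KerTensor.mk (kpr5 k) (kpr12 k) (n ⊗ₜ a) = op a • KerTensor.tmulOne _ _ n := by
      rw [KerTensor.tmulOne_apply, KerTensor.op_smul_tmul, one_mul]; rfl
    rw [this]
    exact Submodule.smul_mem _ _ (tmulOne_mem_range k n)
  | add s t hs ht => rw [map_add]; exact add_mem hs ht

theorem bimodHom_bimodInv (m : MB k) : bimodHom k (bimodInv k m) = m := by
  obtain ⟨a, rfl⟩ := bimodHom_surjective k m
  rw [bimodInv_bimodHom]

/-- The map `Φ` as an isomorphism. -/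
def bimodEquiv : (Fin 3 → VV k) ≃ₗ[(VV k)ᵐᵒᵖ] MB k :=
  { bimodHom k with
    invFun := bimodInv k
    left_inv := bimodInv_bimodHom k
    right_inv := bimodHom_bimodInv k }

/-- The inverse of `Φ` is equivariant, by the Leibniz rule and `D ∘ ℓ = 0`. -/
theorem bimodInv_rRhoBold (v : VB k) (m : MB k) :
    bimodInv k (rRhoBold k v m) = rRhoAct k v (bimodInv k m) := by
  obtain ⟨t, rfl⟩ := KerTensor.mk_surjective _ _ m
  induction t using TensorProduct.induction_on with
  | zero => simp only [map_zero]
  | tmul n a =>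
    funext i
    change foxD k (kell k v * KerMod.incl _ n) i * a =
      (rRho k v *ᵥ fun j => foxD k (KerMod.incl _ n) j * a) i
    have h : (fun j => foxD k (KerMod.incl _ n) j * a) = op a • foxD k (KerMod.incl _ n) := rfl
    rw [foxD_mul, kpr5_kell, foxD_kell, h, Matrix.mulVec_smul]
    simp
  | add s t hs ht => simp only [map_add, hs, ht]

theorem bimodHom_rRhoAct (v : VB k) (a : Fin 3 → VV k) :
    bimodHom k (rRhoAct k v a) = rRhoBold k v (bimodHom k a) := by
  rw [← bimodHom_bimodInv k (rRhoBold k v (bimodHom k a)), bimodInv_rRhoBold, bimodInv_bimodHom]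

end Iso

/-! ### Filtrations -/

section Filtrations

open scoped Matrix

variable (k : Type*) [CommRing k]

section Group

variable (G : Type*) [Group G]

theorem augFil_zero : augFil k G 0 = ⊤ := if_pos le_rfl

theorem augFil_natCast_succ (n : ℕ) : augFil k G (n + 1 : ℕ) = augIdeal k G ^ (n + 1) := by
  rw [augFil, if_neg (by omega), Int.toNat_natCast]

theorem augFil_toNat (n : ℤ) : augFil k G n.toNat = augFil k G n := by
  rcases le_total n 0 with h | h
  · rw [Int.toNat_of_nonpos h, augFil, augFil, if_pos h, if_pos (by simp)]
  · rw [Int.toNat_of_nonneg h]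

theorem augIdeal_mul_top : augIdeal k G * ⊤ ≤ augIdeal k G := by
  refine Submodule.mul_le.2 fun x hx y _ => ?_
  induction y using MonoidAlgebra.induction_on with
  | of h =>
    induction hx using Submodule.span_induction with
    | mem x hx =>
      obtain ⟨g, rfl⟩ := hx
      have : (MonoidAlgebra.of k G g - 1) * MonoidAlgebra.of k G h =
          (MonoidAlgebra.of k G (g * h) - 1) - (MonoidAlgebra.of k G h - 1) := by
        rw [map_mul]; noncomm_ring
      simp only [this]
      exact sub_mem (Submodule.subset_span ⟨_, rfl⟩) (Submodule.subset_span ⟨_, rfl⟩)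
    | zero => rw [zero_mul]; exact zero_mem _
    | add x y _ _ hx hy => rw [add_mul]; exact add_mem hx hy
    | smul r x _ hx => rw [smul_mul_assoc]; exact Submodule.smul_mem _ r hx
  | add y z hy hz => rw [mul_add]; exact add_mem (hy trivial) (hz trivial)
  | smul r y hy => rw [mul_smul_comm]; exact Submodule.smul_mem _ r (hy trivial)

theorem top_mul_augIdeal : ⊤ * augIdeal k G ≤ augIdeal k G := by
  refine Submodule.mul_le.2 fun y _ x hx => ?_
  induction y using MonoidAlgebra.induction_on with
  | of h =>
    induction hx using Submodule.span_induction with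
    | mem x hx =>
      obtain ⟨g, rfl⟩ := hx
      have : MonoidAlgebra.of k G h * (MonoidAlgebra.of k G g - 1) =
          (MonoidAlgebra.of k G (h * g) - 1) - (MonoidAlgebra.of k G h - 1) := by
        rw [map_mul]; noncomm_ring
      simp only [this]
      exact sub_mem (Submodule.subset_span ⟨_, rfl⟩) (Submodule.subset_span ⟨_, rfl⟩)
    | zero => rw [mul_zero]; exact zero_mem _
    | add x y _ _ hx hy => rw [mul_add]; exact add_mem hx hy
    | smul r x _ hx => rw [mul_smul_comm]; exact Submodule.smul_mem _ r hx
  | add y z hy hz => rw [add_mul]; exact add_mem (hy trivial) (hz trivial)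
  | smul r y hy => rw [smul_mul_assoc]; exact Submodule.smul_mem _ r (hy trivial)

theorem augFil_mul_le (i j : ℕ) : augFil k G i * augFil k G j ≤ augFil k G (i + j : ℕ) := by
  rcases i with _ | i <;> rcases j with _ | j
  · simp only [Nat.cast_zero, augFil_zero, Nat.add_zero]; exact le_top
  · rw [Nat.cast_zero, augFil_zero, zero_add, augFil_natCast_succ, pow_succ', ← mul_assoc]
    gcongr
    exact top_mul_augIdeal k G
  · rw [Nat.cast_zero, augFil_zero, add_zero, augFil_natCast_succ, pow_succ, mul_assoc]
    gcongr
    exact augIdeal_mul_top k G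
  · rw [← add_assoc, augFil_natCast_succ, augFil_natCast_succ, augFil_natCast_succ, ← pow_add]
    exact (congrArg (augIdeal k G ^ ·) (by ring)).le

theorem augFil_antitone : Antitone (augFil k G) := by
  have h : Antitone fun n : ℕ => augFil k G n := antitone_nat_of_succ_le fun n => by
    rcases n with _ | n
    · rw [Nat.cast_zero, augFil_zero]; exact le_top
    · rw [augFil_natCast_succ, augFil_natCast_succ, pow_succ]
      refine le_trans ?_ (?_ : augIdeal k G ^ (n + 1) * ⊤ ≤ _)
      · gcongr
        exact le_top
      · rw [pow_succ, mul_assoc]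
        gcongr
        exact augIdeal_mul_top k G
  intro m n hmn
  rw [← augFil_toNat, ← augFil_toNat k G m]
  exact h (Int.toNat_le_toNat hmn)

variable {k G}

/-- An algebra morphism from `k G` to a filtered algebra is filtered if it maps every `g - 1` to
degree one. -/
theorem map_augFil_le {B : Type*} [Ring B] [Algebra k B] (φ : MonoidAlgebra k G →ₐ[k] B)
    (F : ℕ → Submodule k B) (h0 : F 0 = ⊤) (hmul : ∀ i j, F i * F j ≤ F (i + j))
    (h1 : ∀ g, φ (.of k G g) - 1 ∈ F 1) (n : ℕ) :
    (augFil k G n).map φ.toLinearMap ≤ F n := by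
  rcases n with _ | n
  · rw [h0]; exact le_top
  have hI : (augIdeal k G).map φ.toLinearMap ≤ F 1 := by
    rw [augIdeal, Submodule.map_span, Submodule.span_le]
    rintro _ ⟨_, ⟨g, rfl⟩, rfl⟩
    simpa using h1 g
  rw [augFil_natCast_succ, Submodule.map_pow]
  induction n with
  | zero => simpa using hI
  | succ n ih => rw [pow_succ]; exact (mul_le_mul' ih hI).trans (hmul _ _)

end Group

theorem tmul_mem_filVV {i j : ℕ} {a b : VB k} (ha : a ∈ augFil k F2 i) (hb : b ∈ augFil k F2 j) :
    a ⊗ₜ b ∈ filVV k (i + j : ℕ) := by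
  refine Submodule.mem_iSup_of_mem i (Submodule.mem_iSup_of_mem j
    (Submodule.mem_iSup_of_mem (Int.toNat_natCast _).symm ?_))
  exact ⟨(⟨a, ha⟩ : augFil k F2 i) ⊗ₜ (⟨b, hb⟩ : augFil k F2 j), by simp⟩

theorem filVV_le_iff {n : ℤ} {S : Submodule k (VV k)} : filVV k n ≤ S ↔
    ∀ i j : ℕ, i + j = n.toNat → ∀ a ∈ augFil k F2 i, ∀ b ∈ augFil k F2 j, a ⊗ₜ b ∈ S := by
  simp only [filVV, iSup_le_iff]
  refine forall_congr' fun i => forall_congr' fun j => forall_congr' fun _ => ⟨?_, ?_⟩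
  · exact fun h a ha b hb => h
      ⟨(⟨a, ha⟩ : augFil k F2 i) ⊗ₜ (⟨b, hb⟩ : augFil k F2 j), by simp⟩
  · rintro h _ ⟨t, rfl⟩
    induction t using TensorProduct.induction_on with
    | zero => rw [map_zero]; exact zero_mem _
    | tmul a b => exact h a a.2 b b.2
    | add s t hs ht => rw [map_add]; exact add_mem hs ht

theorem filVV_toNat (n : ℤ) : filVV k n.toNat = filVV k n := by
  simp only [filVV, Int.toNat_natCast]

theorem filVV_of_nonpos {n : ℤ} (hn : n ≤ 0) : filVV k n = ⊤ := by
  rw [← filVV_toNat, Int.toNat_of_nonpos hn, eq_top_iff, ← TensorProduct.span_tmul_eq_top,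
    Submodule.span_le]
  rintro _ ⟨a, b, rfl⟩
  exact tmul_mem_filVV k (i := 0) (j := 0) (by simp [augFil_zero]) (by simp [augFil_zero])

theorem filVV_antitone : Antitone (filVV k) := by
  intro m n hmn
  refine (filVV_le_iff k).2 fun i j hij a ha b hb => ?_
  have h : m.toNat = min i m.toNat + (m.toNat - min i m.toNat) := by omega
  rw [← filVV_toNat, h]
  exact tmul_mem_filVV k (augFil_antitone k F2 (by omega) ha) (augFil_antitone k F2 (by omega) hb)

theorem filVV_mul_le_nat (m n : ℕ) : filVV k m * filVV k n ≤ filVV k (m + n : ℕ) := by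
  have key : ∀ x ∈ filVV k m, ∀ y ∈ filVV k n, x * y ∈ filVV k (m + n : ℕ) := by
    intro x hx y hy
    have hx' : filVV k m ≤ (filVV k (m + n : ℕ)).comap (LinearMap.mulRight k y) := by
      refine (filVV_le_iff k).2 fun i j hij a ha b hb => ?_
      have hy' : filVV k n ≤ (filVV k (m + n : ℕ)).comap (LinearMap.mulLeft k (a ⊗ₜ[k] b)) := by
        refine (filVV_le_iff k).2 fun i' j' hij' a' ha' b' hb' => ?_
        rw [Submodule.mem_comap, LinearMap.mulLeft_apply, Algebra.TensorProduct.tmul_mul_tmul]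
        have : m + n = (i + i') + (j + j') := by simp only [Int.toNat_natCast] at hij hij'; omega
        rw [this]
        exact tmul_mem_filVV k (augFil_mul_le k F2 _ _ (Submodule.mul_mem_mul ha ha'))
          (augFil_mul_le k F2 _ _ (Submodule.mul_mem_mul hb hb'))
      exact hy' hy
    exact hx' hx
  exact Submodule.mul_le.2 key

theorem mul_mem_filVV {m n : ℤ} {x y : VV k} (hx : x ∈ filVV k m) (hy : y ∈ filVV k n) :
    x * y ∈ filVV k (m + n) := by
  rw [← filVV_toNat] at hx hy
  exact filVV_antitone k (by omega) (filVV_mul_le_nat k _ _ (Submodule.mul_mem_mul hx hy))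

theorem pr12_surjective (p : F2 × F2) : ∃ g : P5, pr1 g = p.1 ∧ pr2 g = p.2 := by
  have key : (pr1.prod pr2).range = ⊤ := by
    have hl : (pr1.prod pr2).range.comap (MonoidHom.inl F2 F2) = ⊤ := by
      rw [eq_top_iff, ← FreeGroup.closure_range_of, Subgroup.closure_le]
      rintro _ ⟨i, rfl⟩
      fin_cases i
      · exact ⟨P5.x .x23, by simp [pr1, pr2, P5.lift_x, pr1Val, pr2Val]⟩
      · exact ⟨P5.x5 1, by simp [pr1, pr2, P5.lift_x, pr1Val, pr2Val, P5.x5]⟩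
    have hr : (pr1.prod pr2).range.comap (MonoidHom.inr F2 F2) = ⊤ := by
      rw [eq_top_iff, ← FreeGroup.closure_range_of, Subgroup.closure_le]
      rintro _ ⟨i, rfl⟩
      fin_cases i
      · exact ⟨P5.x .x14, by simp [pr1, pr2, P5.lift_x, pr1Val, pr2Val]⟩
      · exact ⟨P5.x5 0, by simp [pr1, pr2, P5.lift_x, pr1Val, pr2Val, P5.x5]⟩
    refine eq_top_iff.2 fun p _ => ?_
    have hp : p = MonoidHom.inl F2 F2 p.1 * MonoidHom.inr F2 F2 p.2 := by simp
    rw [hp]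
    exact mul_mem (hl.ge (Subgroup.mem_top p.1)) (hr.ge (Subgroup.mem_top p.2))
  obtain ⟨g, hg⟩ := key.ge (Subgroup.mem_top p)
  exact ⟨g, congrArg Prod.fst hg, congrArg Prod.snd hg⟩

theorem wt_sub_one_mem (p : F2 × F2) : wt k p - 1 ∈ filVV k (1 : ℕ) := by
  have h1 (g : F2) : MonoidAlgebra.of k F2 g - 1 ∈ augFil k F2 (1 : ℕ) := by
    rw [augFil_natCast_succ k F2 0, zero_add, pow_one]
    exact Submodule.subset_span ⟨g, rfl⟩
  have h0 (x : VB k) : x ∈ augFil k F2 (0 : ℕ) := by simp [augFil_zero]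
  have : wt k p - 1 = (MonoidAlgebra.of k F2 p.1 - 1) ⊗ₜ MonoidAlgebra.of k F2 p.2 +
      1 ⊗ₜ (MonoidAlgebra.of k F2 p.2 - 1) := by
    rw [sub_tmul, tmul_sub, Algebra.TensorProduct.one_def]
    simp [wt]
  rw [this]
  exact add_mem (tmul_mem_filVV k (i := 1) (j := 0) (h1 _) (h0 _))
    (tmul_mem_filVV k (i := 0) (j := 1) (h0 _) (h1 _))

theorem map_kpr12_augFil_le (n : ℕ) :
    (augFil k P5 n).map (kpr12 k).toLinearMap ≤ filVV k n := by
  refine map_augFil_le (kpr12 k) (fun n => filVV k n) (filVV_of_nonpos k le_rfl)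
    (filVV_mul_le_nat k) (fun g => ?_) n
  rw [kpr12_of]
  exact wt_sub_one_mem k _

theorem kpr12_surjective : Function.Surjective (kpr12 k) := by
  suffices h : LinearMap.range (kpr12 k).toLinearMap = ⊤ from LinearMap.range_eq_top.1 h
  rw [eq_top_iff, ← TensorProduct.span_tmul_eq_top, Submodule.span_le]
  rintro _ ⟨a, b, rfl⟩
  rw [SetLike.mem_coe]
  induction a using MonoidAlgebra.induction_on with
  | of g =>
    induction b using MonoidAlgebra.induction_on with
    | of h =>
      obtain ⟨p, rfl, rfl⟩ := pr12_surjective (g, h)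
      exact ⟨.of k P5 p, kpr12_of k p⟩
    | add x y hx hy => rw [tmul_add]; exact add_mem hx hy
    | smul r x hx => rw [tmul_smul]; exact Submodule.smul_mem _ r hx
  | add x y hx hy => rw [add_tmul]; exact add_mem hx hy
  | smul r x hx => rw [← smul_tmul']; exact Submodule.smul_mem _ r hx

/-- The morphism `pr₁₂` is strict, as it comes from a surjective morphism of groups. -/
theorem filVV_le_map_kpr12 (n : ℕ) :
    filVV k n ≤ (augFil k P5 n).map (kpr12 k).toLinearMap := by
  have h0 : (augFil k P5 (0 : ℕ)).map (kpr12 k).toLinearMap = ⊤ := by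
    rw [Nat.cast_zero, augFil_zero, Submodule.map_top]
    exact LinearMap.range_eq_top.2 (kpr12_surjective k)
  have hmul (i j : ℕ) : (augFil k P5 i).map (kpr12 k).toLinearMap *
      (augFil k P5 j).map (kpr12 k).toLinearMap ≤
        (augFil k P5 (i + j : ℕ)).map (kpr12 k).toLinearMap := by
    rw [← Submodule.map_mul]
    exact Submodule.map_mono (augFil_mul_le k P5 i j)
  have h1 (p : F2 × F2) : wt k p - 1 ∈ (augFil k P5 (1 : ℕ)).map (kpr12 k).toLinearMap := by
    obtain ⟨g, hg1, hg2⟩ := pr12_surjective p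
    refine ⟨.of k P5 g - 1, ?_, ?_⟩
    · rw [augFil_natCast_succ k P5 0, zero_add, pow_one]
      exact Submodule.subset_span ⟨g, rfl⟩
    · rw [AlgHom.toLinearMap_apply, map_sub, map_one, kpr12_of, hg1, hg2]
  have hl := map_augFil_le (Algebra.TensorProduct.includeLeft : VB k →ₐ[k] VV k)
    (fun n => (augFil k P5 n).map (kpr12 k).toLinearMap) h0 hmul fun g => h1 (g, 1)
  have hr := map_augFil_le (Algebra.TensorProduct.includeRight : VB k →ₐ[k] VV k)
    (fun n => (augFil k P5 n).map (kpr12 k).toLinearMap) h0 hmul fun g => h1 (1, g)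
  refine (filVV_le_iff k).2 fun i j hij a ha b hb => ?_
  have hab : a ⊗ₜ[k] b = (a ⊗ₜ 1) * (1 ⊗ₜ b) := by
    rw [Algebra.TensorProduct.tmul_mul_tmul, mul_one, one_mul]
  rw [Int.toNat_natCast] at hij
  rw [hab, ← hij]
  exact hmul i j (Submodule.mul_mem_mul (hl i ⟨a, ha, rfl⟩) (hr j ⟨b, hb, rfl⟩))

/-- The augmentation of `V ⊗ V`. -/
def augVV : VV k →ₐ[k] k :=
  Algebra.TensorProduct.productMap (MonoidAlgebra.lift k k F2 1) (MonoidAlgebra.lift k k F2 1)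

theorem augVV_wt (p : F2 × F2) : augVV k (wt k p) = 1 := by
  simp [augVV, wt]

theorem mem_filVV_one {x : VV k} (hx : augVV k x = 0) : x ∈ filVV k (1 : ℕ) := by
  have key (y : MonoidAlgebra k P5) :
      kpr12 k y - algebraMap k _ (augVV k (kpr12 k y)) ∈ filVV k (1 : ℕ) := by
    induction y using MonoidAlgebra.induction_on with
    | of g => rw [kpr12_of, augVV_wt, map_one]; exact wt_sub_one_mem k _
    | add x y hx hy => simp only [map_add, add_sub_add_comm]; exact add_mem hx hy
    | smul r x hx =>
      convert Submodule.smul_mem _ r hx using 1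
      rw [map_smul, map_smul, smul_eq_mul, map_mul, smul_sub, ← Algebra.smul_def]
  obtain ⟨y, rfl⟩ := kpr12_surjective k x
  simpa [hx] using key y

/-- The matrices with entries in `Fⁿ(V ⊗ V)`. -/
def matFil (n : ℕ) : Submodule k (Matrix (Fin 3) (Fin 3) (VV k)) where
  carrier := {M | ∀ i j, M i j ∈ filVV k n}
  add_mem' hM hN i j := add_mem (hM i j) (hN i j)
  zero_mem' _ _ := zero_mem _
  smul_mem' r _ hM i j := Submodule.smul_mem _ r (hM i j)

theorem matFil_zero : matFil k 0 = ⊤ :=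
  eq_top_iff.2 fun M _ i j => by rw [Nat.cast_zero, filVV_of_nonpos k le_rfl]; trivial

theorem matFil_mul_le (m n : ℕ) : matFil k m * matFil k n ≤ matFil k (m + n) :=
  Submodule.mul_le.2 fun M hM N hN i j => by
    rw [Matrix.mul_apply]
    exact sum_mem fun l _ => filVV_mul_le_nat k m n (Submodule.mul_mem_mul (hM i l) (hN l j))

theorem augVV_rRho (g : F2) : (rRho k (.of k F2 g)).map (augVV k) = 1 := by
  have hX (i : Fin 2) : augVV k (XU k i) = 1 := by rw [← wt_X, augVV_wt]
  have hY (i : Fin 2) : augVV k (YU k i) = 1 := by rw [← wt_Y, augVV_wt]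
  have hX' (i : Fin 2) : augVV k ↑(XU k i)⁻¹ = 1 := by rw [← wt_X_inv, augVV_wt]
  have hY' (i : Fin 2) : augVV k ↑(YU k i)⁻¹ = 1 := by rw [← wt_Y_inv, augVV_wt]
  have : (((augVV k).mapMatrix : Matrix (Fin 3) (Fin 3) (VV k) →ₐ[k] Matrix (Fin 3) (Fin 3) k) :
      Matrix (Fin 3) (Fin 3) (VV k) →* Matrix (Fin 3) (Fin 3) k).comp (rRhoGrp k) = 1 := by
    refine FreeGroup.ext_hom _ _ fun i => ?_
    fin_cases i
    · refine (congrArg (augVV k).mapMatrix (rRho_X0 k)).trans ?_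
      ext i j
      fin_cases i <;> fin_cases j <;> simp [hX, hY, hX', hY']
    · refine (congrArg (augVV k).mapMatrix (rRho_X1 k)).trans ?_
      ext i j
      fin_cases i <;> fin_cases j <;> simp [hX, hY]
  exact DFunLike.congr_fun this g

/-- The matrices `rρ(X₀)` and `rρ(X₁)` are congruent to the identity modulo the augmentation ideal. -/
theorem rRho_sub_one_mem (g : F2) : rRho k (.of k F2 g) - 1 ∈ matFil k 1 := fun i j => by
  refine mem_filVV_one k ?_
  have h := congrFun (congrFun (augVV_rRho k g) i) j
  rw [Matrix.map_apply] at h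
  rw [Matrix.sub_apply, map_sub, h, Matrix.one_apply, Matrix.one_apply]
  split <;> simp

theorem map_rRho_augFil_le (n : ℕ) :
    (augFil k F2 n).map (rRho k).toLinearMap ≤ matFil k n :=
  map_augFil_le (rRho k) (matFil k) (matFil_zero k) (matFil_mul_le k) (rRho_sub_one_mem k) n

theorem map_rRho_kpr5_augFil_le (n : ℕ) :
    (augFil k P5 n).map ((rRho k).comp (kpr5 k)).toLinearMap ≤ matFil k n :=
  map_augFil_le _ (matFil k) (matFil_zero k) (matFil_mul_le k)
    (fun g => by rw [AlgHom.comp_apply, groupAlgMap_of]; exact rRho_sub_one_mem k _) n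

theorem mem_filVV3 {n : ℤ} {a : Fin 3 → VV k} : a ∈ filVV3 k n ↔ ∀ i, a i ∈ filVV k n := by
  simp [filVV3]

theorem mulVec_mem_filVV3 {m : ℕ} {n : ℤ} {M : Matrix (Fin 3) (Fin 3) (VV k)}
    {a : Fin 3 → VV k} (hM : M ∈ matFil k m) (ha : a ∈ filVV3 k n) :
    M *ᵥ a ∈ filVV3 k (m + n) :=
  (mem_filVV3 k).2 fun i => by
    change ∑ j, M i j * a j ∈ _
    exact sum_mem fun j _ => mul_mem_filVV k (hM i j) ((mem_filVV3 k).1 ha j)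

theorem filVV3_of_nonpos {n : ℤ} (hn : n ≤ 0) : filVV3 k n = ⊤ :=
  eq_top_iff.2 fun a _ => (mem_filVV3 k).2 fun i => by rw [filVV_of_nonpos k hn]; trivial

theorem foxD_mem_filVV3_nat (n : ℕ) {x : MonoidAlgebra k P5} (hx : x ∈ augFil k P5 (n + 1 : ℕ)) :
    foxD k x ∈ filVV3 k n := by
  induction n generalizing x with
  | zero => rw [filVV3_of_nonpos k (by simp)]; trivial
  | succ n ih =>
    rw [augFil_natCast_succ, pow_succ] at hx
    have hle : augIdeal k P5 ^ (n + 1) * augIdeal k P5 ≤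
        (filVV3 k (n + 1 : ℕ)).comap (foxD k) := by
      refine Submodule.mul_le.2 fun x hx y hy => ?_
      rw [← augFil_natCast_succ] at hx
      have hy' : y ∈ augFil k P5 (1 : ℕ) := by
        rwa [augFil_natCast_succ k P5 0, zero_add, pow_one]
      rw [Submodule.mem_comap, foxD_mul]
      -- the first term gains its degree from `x`, the second one from `x` and `y`
      refine add_mem ?_ ((mem_filVV3 k).2 fun i => ?_)
      · have := mulVec_mem_filVV3 k (n := 0) (map_rRho_kpr5_augFil_le k (n + 1) ⟨x, hx, rfl⟩)
          (a := foxD k y) (by rw [filVV3_of_nonpos k le_rfl]; trivial)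
        rwa [add_zero] at this
      · have hky : kpr12 k y ∈ filVV k (1 : ℕ) := map_kpr12_augFil_le k 1 ⟨y, hy', rfl⟩
        exact filVV_mul_le_nat k n 1
          (Submodule.mul_mem_mul ((mem_filVV3 k).1 (ih hx) i) hky)
    exact hle hx

theorem foxD_mem_filVV3 {n : ℤ} {x : MonoidAlgebra k P5} (hx : x ∈ augFil k P5 n) :
    foxD k x ∈ filVV3 k (n - 1) := by
  rcases le_or_gt n 1 with h | h
  · rw [filVV3_of_nonpos k (by omega)]; trivial
  · obtain ⟨m, rfl⟩ : ∃ m : ℕ, n = (m + 1 : ℕ) := ⟨(n - 1).toNat, by omega⟩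
    have := foxD_mem_filVV3_nat k m hx
    rwa [Nat.cast_succ, add_sub_cancel_right]

theorem image_bimodHom_filVV3 (n : ℤ) :
    bimodHom k '' (filVV3 k (n - 1) : Set (Fin 3 → VV k)) = (filMB k n : Set (MB k)) := by
  apply Set.Subset.antisymm
  · rintro _ ⟨a, ha, rfl⟩
    change ∑ i : Fin 3, KerTensor.tmul (kpr5 k) (kpr12 k) (x5SubOne k i) (a i) ∈ filMB k n
    refine sum_mem fun i _ => ?_
    have hai := (mem_filVV3 k).1 ha i
    rw [← filVV_toNat] at hai
    obtain ⟨b, hb, hba⟩ := filVV_le_map_kpr12 k _ hai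
    refine ⟨kerMulRight (kpr5 k) b (x5SubOne k i), ?_, ?_⟩
    · change (MonoidAlgebra.of k P5 (P5.x5 i) - 1) * b ∈ augFil k P5 n
      have h1 : MonoidAlgebra.of k P5 (P5.x5 i) - 1 ∈ augFil k P5 (1 : ℕ) := by
        rw [augFil_natCast_succ k P5 0, zero_add, pow_one]
        exact Submodule.subset_span ⟨_, rfl⟩
      exact augFil_antitone k P5 (by omega)
        (augFil_mul_le k P5 _ _ (Submodule.mul_mem_mul h1 hb))
    · rw [KerTensor.tmulOne_apply, KerTensor.tmul_balanced, mul_one, ← hba]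
      rfl
  · rintro _ ⟨x, hx, rfl⟩
    refine ⟨bimodInv k (KerTensor.tmulOne _ _ x), ?_, bimodHom_bimodInv k _⟩
    have : bimodInv k (KerTensor.tmulOne _ _ x) = foxD k (KerMod.incl _ x) :=
      funext fun i => mul_one _
    rw [this]
    exact foxD_mem_filVV3 k hx

theorem isFilteredBimodule_filVV3 :
    IsFilteredBimodule (rRhoAct k) (augFil k F2) (filVV k) (filVV3 k) where
  antitone m n hmn a ha :=
    (mem_filVV3 k).2 fun i => filVV_antitone k hmn ((mem_filVV3 k).1 ha i)
  smul_mem m n a c ha hc :=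
    (mem_filVV3 k).2 fun i => mul_mem_filVV k ((mem_filVV3 k).1 ha i) hc
  act_mem m n v a hv ha := by
    rw [← augFil_toNat] at hv
    have h := mulVec_mem_filVV3 k (map_rRho_augFil_le k _ ⟨v, hv, rfl⟩) ha
    exact (mem_filVV3 k).2 fun i => filVV_antitone k (by omega) ((mem_filVV3 k).1 h i)

theorem mem_filMB {n : ℤ} {m : MB k} :
    m ∈ filMB k n ↔ ∃ a ∈ filVV3 k (n - 1), bimodHom k a = m := by
  rw [← SetLike.mem_coe, ← image_bimodHom_filVV3]
  rfl

theorem isFilteredBimodule_filMB :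
    IsFilteredBimodule (rRhoBold k) (augFil k F2) (filVV k) (filMB k) where
  antitone m n hmn x hx := by
    obtain ⟨a, ha, rfl⟩ := (mem_filMB k).1 hx
    exact (mem_filMB k).2
      ⟨a, (isFilteredBimodule_filVV3 k).antitone (sub_le_sub_right hmn 1) ha, rfl⟩
  smul_mem m n x c hx hc := by
    obtain ⟨a, ha, rfl⟩ := (mem_filMB k).1 hx
    refine (mem_filMB k).2 ⟨op c • a, ?_, map_smul _ _ _⟩
    rw [add_sub_right_comm]
    exact (isFilteredBimodule_filVV3 k).smul_mem _ _ _ _ ha hc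
  act_mem m n v x hv hx := by
    obtain ⟨a, ha, rfl⟩ := (mem_filMB k).1 hx
    refine (mem_filMB k).2 ⟨rRhoAct k v a, ?_, bimodHom_rRhoAct k v a⟩
    rw [add_sub_assoc]
    exact (isFilteredBimodule_filVV3 k).act_mem _ _ _ _ hv ha

end Filtrations

end BettiBimodule

end

theorem mainTheorem2 (k : Type*) [CommRing k] [Algebra ℚ k] :
    ∃ Φ : (Fin 3 → BettiBimodule.VV k) ≃ₗ[(BettiBimodule.VV k)ᵐᵒᵖ] BettiBimodule.MB k,
      (∀ a : Fin 3 → BettiBimodule.VV k,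
        Φ a = ∑ i : Fin 3, BettiBimodule.KerTensor.tmul (BettiBimodule.kpr5 k)
          (BettiBimodule.kpr12 k) (BettiBimodule.x5SubOne k i) (a i)) ∧
      (∀ (v : BettiBimodule.VB k) (a : Fin 3 → BettiBimodule.VV k),
        Φ (BettiBimodule.rRhoAct k v a) = BettiBimodule.rRhoBold k v (Φ a)) ∧
      BettiBimodule.IsFilteredBimodule (BettiBimodule.rRhoAct k)
        (BettiBimodule.augFil k BettiBimodule.F2) (BettiBimodule.filVV k)
        (BettiBimodule.filVV3 k) ∧
      BettiBimodule.IsFilteredBimodule (BettiBimodule.rRhoBold k)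
        (BettiBimodule.augFil k BettiBimodule.F2) (BettiBimodule.filVV k)
        (BettiBimodule.filMB k) ∧
      ∀ n : ℤ, Φ '' (BettiBimodule.filVV3 k (n - 1) : Set (Fin 3 → BettiBimodule.VV k)) =
        (BettiBimodule.filMB k n : Set (BettiBimodule.MB k)) :=
  ⟨BettiBimodule.bimodEquiv k, fun _ => rfl, BettiBimodule.bimodHom_rRhoAct k,
    BettiBimodule.isFilteredBimodule_filVV3 k, BettiBimodule.isFilteredBimodule_filMB k,
    BettiBimodule.image_bimodHom_filVV3 k⟩
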